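/- Let valuations be pairs $v=(v_s,v_b)\in[0,1]^2$ (seller, buyer), and say that $y$ dominates $x$ if $y_1\le x_1$ and $y_2\ge x_2$. \textbf{Mechanisms.} A mechanism $M$ consists of a closed allocation region $A_M\subseteq[0,1]^2$ and payments $p,q:[0,1]^2\to[0,1]$ (to the seller, from the buyer) that vanish outside $A_M$; its profit is $\mathrm{profit}(M,v)=q(v)-p(v)$. $\mathcal M$ is the class of dominant-strategy incentive compatible and individually rational mechanisms, and $\mathcal M^+\subseteq\mathcal M$ is the class of those with $A_M\subseteq\{(x,y):x\le y\}$. A set $A$ determines a mechanism with region $A$ and Myerson payments $p(v)=\max\{x:(x,v_b)\in A\}$, $q(v)=\min\{y:(v_s,y)\in A\}$ for $v\in A$. \textbf{Grids.} The grid induced by a finite set of points consists of the vertical lines at abscissae $0$, $1$ and those of the points, and of the horizontal lines at ordinates $0$, $1$ and those of the points, with edges directed right and up. A complete path is a directed path from a node on the left side to a node on the upper side of the square; it induces the mechanism with Myerson payments whose region is the set of all points that dominate a point of the path. $G_\varepsilon$ is the grid induced by the points $(i\varepsilon,i\varepsilon)$, $1\le i\le\lfloor1/\varepsilon\rfloor$.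 \textbf{Simplification.} $\partial M$ is the set of points of $A_M$ every neighbourhood of which meets $[0,1]^2\setminus A_M$. The simplified mechanism $M_\varepsilon$ is induced by the path that contains $\partial M\cap G_\varepsilon$ and joins consecutive points $v,v'$ of this intersection (ordered left to right and bottom to top) by the segments from $v$ to $(v_1',v_2)$ and from $(v_1',v_2)$ to $v'$. Put $\phi_h(M)=M_{2^{-h}}$ for $h\in\mathbb N$. \textbf{Target net.} Let $\mathcal D$ be a probability distribution on $[0,1]^2$, let $\varepsilon=2^{-H}$ with $H\in\mathbb N$, and let $S=(v^1,\dots,v^n)$ be i.i.d. samples from $\mathcal D$. A mechanism $M\in\mathcal M$ is a candidate if $M=\phi_H(M')$ for some $M'\in\mathcal M^+$ and $$\mathbb E_{v\sim\mathcal D}\big[\mathrm{profit}(\phi_h(M),v)-\mathrm{profit}(\phi_{h+1}(M),v)\big]<4\cdot2^{-h}\qquad\text{for all }h=0,1,\dots,H-1.$$ The target net $\mathcal M^\star(S)$ is the set of all candidates that, for some $I\subseteq\{1,\dots,n\}$ with $|I|=4/\varepsilon$, are induced by a complete path in the grid induced by the points $v^i$, $i\in I$, and $(j\varepsilon,j\varepsilon)$,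 $1\le j\le1/\varepsilon$. \textbf{Theorem.} Let $\varepsilon=2^{-H}$ with $H\in\mathbb N$, let $\delta\in(0,1)$, and let $n\ge\frac{625}{\varepsilon^2}\left(\log\frac{20}{\delta}+\log\frac{20}{\varepsilon}\right)$. For every probability distribution $\mathcal D$ on $[0,1]^2$, with probability at least $1-\delta$ over $n$ i.i.d. samples $S$ from $\mathcal D$, the following holds: for every empirically optimal mechanism $M^\star$, that is, every $M^\star\in\mathcal M^+$ induced by a complete path in the grid induced by the samples with $\sum_{i=1}^n\mathrm{profit}(M^\star,v^i)=\max_{M\in\mathcal M}\sum_{i=1}^n\mathrm{profit}(M,v^i)$, the simplified mechanism $\phi_H(M^\star)$ lies in $\mathcal M^\star(S)$. -/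

import Mathlib

open MeasureTheory

namespace BilateralTrade

/-- The valuation (and bid) space `[0,1]²`; the first coordinate is the seller's, the second the
buyer's. -/
abbrev Square : Type := unitInterval × unitInterval

/-! ### Mechanisms -/

/-- A mechanism: an allocation region, the payment `pay` received by the seller, and the payment
`charge` made by the buyer, both in `[0,1]` and both zero when there is no trade. -/
structure Mechanism where
  alloc : Set Square
  pay : Square → unitInterval
  charge : Square → unitInterval
  pay_eq_zero : ∀ b, b ∉ alloc → pay b = 0
  charge_eq_zero : ∀ b, b ∉ alloc → charge b = 0

/-- Profit of the broker at (truthful) bids `v`. -/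
def Mechanism.profit (M : Mechanism) (v : Square) : ℝ := (M.charge v : ℝ) - (M.pay v : ℝ)

/-- Utility of a seller with valuation `x` under the bids `b`. -/
noncomputable def Mechanism.sellerUtility (M : Mechanism) (x : unitInterval) (b : Square) : ℝ :=
  (x : ℝ) - M.alloc.indicator (fun _ => (x : ℝ)) b + (M.pay b : ℝ)

/-- Utility of a buyer with valuation `y` under the bids `b`. -/
noncomputable def Mechanism.buyerUtility (M : Mechanism) (y : unitInterval) (b : Square) : ℝ :=
  M.alloc.indicator (fun _ => (y : ℝ)) b - (M.charge b : ℝ)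

/-- Dominant-strategy incentive compatibility. -/
def Mechanism.DSIC (M : Mechanism) : Prop :=
  (∀ x bs bb : unitInterval, M.sellerUtility x (bs, bb) ≤ M.sellerUtility x (x, bb)) ∧
  (∀ y bs bb : unitInterval, M.buyerUtility y (bs, bb) ≤ M.buyerUtility y (bs, y))

/-- Individual rationality. -/
def Mechanism.IR (M : Mechanism) : Prop :=
  (∀ x bb : unitInterval, (x : ℝ) ≤ M.sellerUtility x (x, bb)) ∧
  (∀ y bs : unitInterval, 0 ≤ M.buyerUtility y (bs, y))

/-- The class of DSIC and IR mechanisms (allocation regions are always taken closed). -/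
def mechanisms : Set Mechanism := {M | IsClosed M.alloc ∧ M.DSIC ∧ M.IR}

/-- The mechanisms of `mechanisms` that only trade in the upper-left triangle. -/
def mechanismsPlus : Set Mechanism :=
  {M | M ∈ mechanisms ∧ ∀ v ∈ M.alloc, v.1 ≤ v.2}

/-- `Dominates y x`: `y` lies (weakly) north-west of `x`. -/
def Dominates (y x : Square) : Prop := y.1 ≤ x.1 ∧ x.2 ≤ y.2

/-- All points of the square that dominate some point of `T`. -/
def upRegion (T : Set Square) : Set Square := {v | ∃ x ∈ T, Dominates v x}

open Classical in
/-- The mechanism with allocation region `A` and Myerson payments. The supremum and the infimum are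
those of the complete lattice `[0,1]`; they are attained if `A` is closed. -/
noncomputable def myerson (A : Set Square) : Mechanism where
  alloc := A
  pay b := if b ∈ A then sSup {x : unitInterval | (x, b.2) ∈ A} else 0
  charge b := if b ∈ A then sInf {y : unitInterval | (b.1, y) ∈ A} else 0
  pay_eq_zero _ hb := if_neg hb
  charge_eq_zero _ hb := if_neg hb

/-! ### Grids and paths

The grid induced by a set `P` of points. -/

/-- Abscissae of the vertical grid lines. -/
def gridX (P : Set Square) : Set unitInterval := {0, 1} ∪ Prod.fst '' P

/-- Ordinates of the horizontal grid lines. -/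
def gridY (P : Set Square) : Set unitInterval := {0, 1} ∪ Prod.snd '' P

/-- Nodes of the grid. -/
def gridNodes (P : Set Square) : Set Square := gridX P ×ˢ gridY P

/-- Directed edges of the grid: from a node to the next node on its right, or to the next node
above it. -/
def GridEdge (P : Set Square) (u w : Square) : Prop :=
  u ∈ gridNodes P ∧ w ∈ gridNodes P ∧
    ((u.2 = w.2 ∧ u.1 < w.1 ∧ ∀ x ∈ gridX P, ¬ (u.1 < x ∧ x < w.1)) ∨
     (u.1 = w.1 ∧ u.2 < w.2 ∧ ∀ y ∈ gridY P, ¬ (u.2 < y ∧ y < w.2)))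

/-- The grid as a subset of the square: the union of its (horizontal and vertical) lines. -/
def gridSet (P : Set Square) : Set Square := {v | v.1 ∈ gridX P ∨ v.2 ∈ gridY P}

/-- A complete path in the grid: a directed path from the left side to the upper side of the
square. -/
structure CompletePath (P : Set Square) where
  nodes : List Square
  ne_nil : nodes ≠ []
  mem_gridNodes : ∀ u ∈ nodes, u ∈ gridNodes P
  isChain : nodes.IsChain (GridEdge P)
  start : (nodes.head ne_nil).1 = 0
  finish : (nodes.getLast ne_nil).2 = 1

/-- The curve drawn by a path: its nodes and its edges. As `u` and `w` share a coordinate, the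
order interval `Set.Icc u w` of the product order is the segment from `u` to `w`. -/
def CompletePath.curve {P : Set Square} (π : CompletePath P) : Set Square :=
  {z | z ∈ π.nodes} ∪ {z | ∃ u w, [u, w] <:+: π.nodes ∧ z ∈ Set.Icc u w}

/-- The mechanism induced by a complete path. -/
noncomputable def CompletePath.mechanism {P : Set Square} (π : CompletePath P) : Mechanism :=
  myerson (upRegion π.curve)

/-! ### Simplification -/

/-- The diagonal points `(iε, iε)`, `i = 1, …, ⌊1/ε⌋`, which induce the uniform grid. -/
def uniformPoints (ε : ℝ) : Set Square :=
  {z | ∃ i : ℕ, 1 ≤ i ∧ i ≤ ⌊1 / ε⌋₊ ∧ (z.1 : ℝ) = i * ε ∧ (z.2 : ℝ) = i * ε}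

/-- The boundary of a mechanism, relative to the square. -/
def Mechanism.boundary (M : Mechanism) : Set Square :=
  {v | v ∈ M.alloc ∧ ∀ r > 0, (M.allocᶜ ∩ Metric.ball v r).Nonempty}

/-- The points at which the boundary of `M` meets the uniform `ε`-grid. -/
def Mechanism.crossings (M : Mechanism) (ε : ℝ) : Set Square :=
  M.boundary ∩ gridSet (uniformPoints ε)

/-- `v` comes directly before `w` in `K`, in the left-to-right and bottom-up order. -/
def Consecutive (K : Set Square) (v w : Square) : Prop :=
  v ∈ K ∧ w ∈ K ∧ v < w ∧ ∀ z ∈ K, v ≤ z → z ≤ w → z = v ∨ z = w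

/-- The path that defines the simplified mechanism: it contains all crossings, and it joins
consecutive crossings `v`, `w` by a horizontal segment from `v` to the corner `(w.1, v.2)` followed
by a vertical segment from this corner to `w` (one of the two is trivial when `v` and `w` lie on a
common horizontal or vertical line). A segment that the boundary shares with the grid consists of
crossings, so it belongs to the path as a whole; to keep only its two ends as crossings and to
join these by the edge between them gives the same curve. -/
def Mechanism.simplePath (M : Mechanism) (ε : ℝ) : Set Square :=
  M.crossings ε ∪
    {z | ∃ v w, Consecutive (M.crossings ε) v w ∧
      (z ∈ Set.Icc v (w.1, v.2) ∨ z ∈ Set.Icc (w.1, v.2) w)}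

/-- The simplified mechanism with precision `ε`. -/
noncomputable def Mechanism.simplify (M : Mechanism) (ε : ℝ) : Mechanism :=
  myerson (upRegion (M.simplePath ε))

/-- The precision `2^{-h}`. -/
noncomputable def prec (h : ℕ) : ℝ := (1 / 2) ^ h

/-- The approximating sequence `φ_h(M)`. -/
noncomputable def approx (h : ℕ) (M : Mechanism) : Mechanism := M.simplify (prec h)

/-! ### Empirical optimum and target net -/

/-- `M` is a profit-maximizing mechanism on the sample `S`, contained in the upper-left triangle and
supported on the grid induced by the sample. -/
def IsEmpiricalOptimum {n : ℕ} (S : Fin n → Square) (M : Mechanism) : Prop :=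
  M ∈ mechanismsPlus ∧
  (∃ π : CompletePath (Set.range S), M = π.mechanism) ∧
  ∀ M' ∈ mechanisms, ∑ i, M'.profit (S i) ≤ ∑ i, M.profit (S i)

/-- The mechanisms induced by complete paths on the grid induced by the samples with index in `I`
and by the uniform `ε`-grid. -/
def dataNet {n : ℕ} (ε : ℝ) (S : Fin n → Square) (I : Finset (Fin n)) : Set Mechanism :=
  {M | ∃ π : CompletePath (S '' (I : Set (Fin n)) ∪ uniformPoints ε), M = π.mechanism}

/-- The candidates of level `H` for the distribution `D`: level-`H` simplifications of mechanisms
in `mechanismsPlus`, whose approximating sequence loses less than `4 · 2^{-h}` in expectation at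
every level `h < H`. -/
def candidates (D : Measure Square) (H : ℕ) : Set Mechanism :=
  {M | M ∈ mechanisms ∧ (∃ M' ∈ mechanismsPlus, M = approx H M') ∧
    ∀ h < H, ∫ v, ((approx h M).profit v - (approx (h + 1) M).profit v) ∂D < 4 * prec h}

/-- The target net. -/
def targetNet (D : Measure Square) (H : ℕ) {n : ℕ} (S : Fin n → Square) : Set Mechanism :=
  (⋃ I ∈ {I : Finset (Fin n) | (I.card : ℝ) = 4 / prec H}, dataNet (prec H) S I) ∩ candidates D H

end BilateralTrade

namespace BilateralTrade

/-! For a closed upward closed region `A` containing the north-west but not the south-east corner,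
the level-`h` simplification is the Myerson mechanism of `coarsen (2 ^ h) A`, the region cut out by
the constraints that `A` imposes at grid lines (`approx_eq_myerson`). A finer coarsening does not
change the constraints at coarser lines, so simplifying the simplified optimum again gives the
coarsenings of the optimal region itself (`approx_approx`). It remains to control the gap in profit
between the meshes `1/m` and `1/(2m)`, for `m = 2^h`.

Coarsening to mesh `1/m` costs at most `2/m` pointwise: where `A` trades, each Myerson price moves
by at most `1/m`, and a new trade loses at most `2/m` because `A` lies above the diagonal. Hence the
gap is at least `-2/m`. On the sample its mean is at most `1/m`, since the optimum earns at least as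
much as the coarser region and the finer region loses at most `1/m` against the optimum. If the
expected gap were at least `4/m`, the gap shifted by `2/m` would be nonnegative with mean at least
`6/m` and sample mean at most `3/m`. A multiplicative Chernoff bound makes this exponentially
unlikely in `n/m`.

The optimal region depends on the sample, but its two coarsenings depend only on `6m + 4`
thresholds, each a coordinate of a sample point or `0` or `1`. For each of the `(n+2)^(6m+4)` ways
to choose them, the sample points used are frozen and the others are still i.i.d.
(`measure_compressed_sum_le`). A union bound over choices and levels gives the theorem.

Membership in the data net is deterministic: the thresholds at mesh `ε` use at most `2(1/ε + 1) ≤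
4/ε` samples, and on the grid they induce with the uniform points a staircase path generates the
coarsened region (`exists_completePath`). -/

/-! ### Upward closed regions -/

/-- `A` contains every point that dominates one of its points. -/
def IsUpper (A : Set Square) : Prop := ∀ ⦃x⦄, x ∈ A → ∀ ⦃y⦄, Dominates y x → y ∈ A

lemma Dominates.trans {x y z : Square} (h : Dominates x y) (h' : Dominates y z) :
    Dominates x z := ⟨h.1.trans h'.1, h'.2.trans h.2⟩

lemma Dominates.refl (x : Square) : Dominates x x := ⟨le_rfl, le_rfl⟩

lemma isUpper_upRegion (T : Set Square) : IsUpper (upRegion T) :=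
  fun _ ⟨c, hc, hxc⟩ _ hy => ⟨c, hc, hy.trans hxc⟩

/-- Infimum of the ordinates of `A` strictly to the right of `ξ`. -/
noncomputable def rightInf (A : Set Square) (ξ : ℝ) : unitInterval :=
  sInf {y | ∃ x : unitInterval, ξ < x ∧ (x, y) ∈ A}

/-- Supremum of the abscissae of `A` strictly below `η`. -/
noncomputable def lowerSup (A : Set Square) (η : ℝ) : unitInterval :=
  sSup {x | ∃ y : unitInterval, (y : ℝ) < η ∧ (x, y) ∈ A}

lemma rightInf_le {A : Set Square} {ξ : ℝ} {z : Square} (hz : z ∈ A) (h : ξ < z.1) :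
    rightInf A ξ ≤ z.2 := sInf_le ⟨z.1, h, hz⟩

lemma le_lowerSup {A : Set Square} {η : ℝ} {z : Square} (hz : z ∈ A) (h : (z.2 : ℝ) < η) :
    z.1 ≤ lowerSup A η := le_sSup ⟨z.2, h, hz⟩

lemma exists_of_rightInf_lt {A : Set Square} {ξ : ℝ} {y : unitInterval} (h : rightInf A ξ < y) :
    ∃ z ∈ A, ξ < z.1 ∧ z.2 < y := by
  obtain ⟨y', ⟨x, hx, hA⟩, hy'⟩ := sInf_lt_iff.1 h
  exact ⟨(x, y'), hA, hx, hy'⟩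

lemma exists_of_lt_lowerSup {A : Set Square} {η : ℝ} {x : unitInterval} (h : x < lowerSup A η) :
    ∃ z ∈ A, (z.2 : ℝ) < η ∧ x < z.1 := by
  obtain ⟨x', ⟨y, hy, hA⟩, hx'⟩ := lt_sSup_iff.1 h
  exact ⟨(x', y), hA, hy, hx'⟩

lemma isClosed_vertical {A : Set Square} (hA : IsClosed A) (x : unitInterval) :
    IsClosed {y | (x, y) ∈ A} := hA.preimage (by fun_prop)

lemma isClosed_horizontal {A : Set Square} (hA : IsClosed A) (y : unitInterval) :
    IsClosed {x | (x, y) ∈ A} := hA.preimage (by fun_prop)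

lemma sInf_vertical_mem {A : Set Square} (hA : IsClosed A) {v : Square} (hv : v ∈ A) :
    (v.1, sInf {y | (v.1, y) ∈ A}) ∈ A :=
  (isClosed_vertical hA v.1).sInf_mem ⟨v.2, hv⟩

lemma sSup_horizontal_mem {A : Set Square} (hA : IsClosed A) {v : Square} (hv : v ∈ A) :
    (sSup {x | (x, v.2) ∈ A}, v.2) ∈ A :=
  (isClosed_horizontal hA v.2).sSup_mem ⟨v.1, hv⟩

/-- On a vertical line to the left of some point of `A`, the value `rightInf` is attained. -/
lemma rightInf_mem {A : Set Square} (hA : IsClosed A) (hU : IsUpper A) {x : unitInterval}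
    {w : Square} (hw : w ∈ A) (hx : x < w.1) : (x, rightInf A x) ∈ A := by
  have hsub : {y | ∃ x' : unitInterval, (x : ℝ) < x' ∧ (x', y) ∈ A} ⊆ {y | (x, y) ∈ A} := by
    rintro y ⟨x', hx', h⟩
    exact hU h ⟨Subtype.coe_le_coe.1 hx'.le, le_rfl⟩
  have hne : {y | ∃ x' : unitInterval, (x : ℝ) < x' ∧ (x', y) ∈ A}.Nonempty := ⟨w.2, w.1, hx, hw⟩
  exact (isClosed_vertical hA x).closure_subset_iff.2 hsub (sInf_mem_closure hne)

lemma lowerSup_mem {A : Set Square} (hA : IsClosed A) (hU : IsUpper A) {y : unitInterval}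
    {w : Square} (hw : w ∈ A) (hy : w.2 < y) : (lowerSup A y, y) ∈ A := by
  have hsub : {x | ∃ y' : unitInterval, (y' : ℝ) < y ∧ (x, y') ∈ A} ⊆ {x | (x, y) ∈ A} := by
    rintro x ⟨y', hy', h⟩
    exact hU h ⟨le_rfl, Subtype.coe_le_coe.1 hy'.le⟩
  have hne : {x | ∃ y' : unitInterval, (y' : ℝ) < y ∧ (x, y') ∈ A}.Nonempty := ⟨w.1, w.2, hy, hw⟩
  exact (isClosed_horizontal hA y).closure_subset_iff.2 hsub (sSup_mem_closure hne)

/-! ### Myerson payments -/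

lemma myerson_charge_of_mem {A : Set Square} {v : Square} (hv : v ∈ A) :
    (myerson A).charge v = sInf {y | (v.1, y) ∈ A} := if_pos hv

lemma myerson_pay_of_mem {A : Set Square} {v : Square} (hv : v ∈ A) :
    (myerson A).pay v = sSup {x | (x, v.2) ∈ A} := if_pos hv

lemma profit_of_notMem {M : Mechanism} {v : Square} (hv : v ∉ M.alloc) : M.profit v = 0 := by
  simp [Mechanism.profit, M.pay_eq_zero v hv, M.charge_eq_zero v hv]

lemma profit_le_one (M : Mechanism) (v : Square) : M.profit v ≤ 1 := by
  have := (M.charge v).2.2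
  have := (M.pay v).2.1
  unfold Mechanism.profit; linarith

/-- The payments are threshold prices: a bid cannot change one's own price while trade goes on. As
`A` is closed, the threshold point lies in `A`, so upward closedness forbids a non-trading agent a
valuation strictly on the trading side of it. -/
lemma myerson_mem_mechanisms {A : Set Square} (hA : IsClosed A) (hU : IsUpper A) :
    myerson A ∈ mechanisms := by
  have hIRs (x bb : unitInterval) : (x : ℝ) ≤ (myerson A).sellerUtility x (x, bb) := by
    by_cases h : (x, bb) ∈ A
    · have : x ≤ (myerson A).pay (x, bb) := by
        rw [myerson_pay_of_mem h]; exact le_sSup h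
      have : (x : ℝ) ≤ (myerson A).pay (x, bb) := this
      have h' : (x, bb) ∈ (myerson A).alloc := h
      simp only [Mechanism.sellerUtility, Set.indicator_of_mem h']; linarith
    · have h' : (x, bb) ∉ (myerson A).alloc := h
      simp [Mechanism.sellerUtility, Set.indicator_of_notMem h', Mechanism.pay_eq_zero _ _ h']
  have hIRb (y bs : unitInterval) : 0 ≤ (myerson A).buyerUtility y (bs, y) := by
    by_cases h : (bs, y) ∈ A
    · have : (myerson A).charge (bs, y) ≤ y := by
        rw [myerson_charge_of_mem h]; exact sInf_le h
      have : ((myerson A).charge (bs, y) : ℝ) ≤ y := this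
      have h' : (bs, y) ∈ (myerson A).alloc := h
      simp only [Mechanism.buyerUtility, Set.indicator_of_mem h']; linarith
    · have h' : (bs, y) ∉ (myerson A).alloc := h
      simp [Mechanism.buyerUtility, Set.indicator_of_notMem h', Mechanism.charge_eq_zero _ _ h']
  refine ⟨hA, ⟨fun x bs bb => ?_, fun y bs bb => ?_⟩, hIRs, hIRb⟩
  · by_cases h : (bs, bb) ∈ A
    · have h1 : (bs, bb) ∈ (myerson A).alloc := h
      by_cases h' : (x, bb) ∈ A
      · have h2 : (x, bb) ∈ (myerson A).alloc := h'
        simp [Mechanism.sellerUtility, Set.indicator_of_mem h1, Set.indicator_of_mem h2,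
          myerson_pay_of_mem h, myerson_pay_of_mem h']
      · have h2 : (x, bb) ∉ (myerson A).alloc := h'
        have hle : (myerson A).pay (bs, bb) ≤ x := by
          rw [myerson_pay_of_mem h]
          by_contra! hlt
          exact h' (hU (sSup_horizontal_mem hA h) ⟨hlt.le, le_rfl⟩)
        have hle : ((myerson A).pay (bs, bb) : ℝ) ≤ x := hle
        simp only [Mechanism.sellerUtility, Set.indicator_of_mem h1, Set.indicator_of_notMem h2,
          Mechanism.pay_eq_zero _ _ h2]
        simpa using hle
    · have h1 : (bs, bb) ∉ (myerson A).alloc := h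
      refine le_trans ?_ (hIRs x bb)
      simp [Mechanism.sellerUtility, Set.indicator_of_notMem h1, Mechanism.pay_eq_zero _ _ h1]
  · by_cases h : (bs, bb) ∈ A
    · have h1 : (bs, bb) ∈ (myerson A).alloc := h
      by_cases h' : (bs, y) ∈ A
      · have h2 : (bs, y) ∈ (myerson A).alloc := h'
        simp [Mechanism.buyerUtility, Set.indicator_of_mem h1, Set.indicator_of_mem h2,
          myerson_charge_of_mem h, myerson_charge_of_mem h']
      · have h2 : (bs, y) ∉ (myerson A).alloc := h'
        have hle : y ≤ (myerson A).charge (bs, bb) := by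
          rw [myerson_charge_of_mem h]
          by_contra! hlt
          exact h' (hU (sInf_vertical_mem hA h) ⟨le_rfl, hlt.le⟩)
        have hle : (y : ℝ) ≤ (myerson A).charge (bs, bb) := hle
        simp only [Mechanism.buyerUtility, Set.indicator_of_mem h1, Set.indicator_of_notMem h2,
          Mechanism.charge_eq_zero _ _ h2]
        simpa using hle
    · have h1 : (bs, bb) ∉ (myerson A).alloc := h
      refine le_trans ?_ (hIRb y bs)
      simp [Mechanism.buyerUtility, Set.indicator_of_notMem h1, Mechanism.charge_eq_zero _ _ h1]

/-! ### Coarsening a region -/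

/-- The largest region that agrees with `A` on the grid with mesh `1 / m`. -/
def coarsen (m : ℕ) (A : Set Square) : Set Square :=
  {z | (∀ k : ℤ, (k / m : ℝ) < z.1 → rightInf A (k / m) ≤ z.2) ∧
    ∀ k : ℤ, (z.2 : ℝ) < k / m → z.1 ≤ lowerSup A (k / m)}

lemma subset_coarsen (m : ℕ) (A : Set Square) : A ⊆ coarsen m A :=
  fun _ hz => ⟨fun _ h => rightInf_le hz h, fun _ h => le_lowerSup hz h⟩

lemma isUpper_coarsen (m : ℕ) (A : Set Square) : IsUpper (coarsen m A) :=
  fun _ hx _ hyx => ⟨fun k hk => (hx.1 k (hk.trans_le hyx.1)).trans hyx.2,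
    fun k hk => hyx.1.trans (hx.2 k (lt_of_le_of_lt hyx.2 hk))⟩

lemma isClosed_coarsen (m : ℕ) (A : Set Square) : IsClosed (coarsen m A) := by
  have : coarsen m A = (⋂ k : ℤ, {z : Square | (z.1 : ℝ) ≤ k / m} ∪ {z | rightInf A (k / m) ≤ z.2}) ∩
      ⋂ k : ℤ, {z : Square | (k / m : ℝ) ≤ z.2} ∪ {z | z.1 ≤ lowerSup A (k / m)} := by
    ext z
    simp only [coarsen, Set.mem_ofPred_eq, Set.mem_inter_iff, Set.mem_iInter, Set.mem_union,
      ← not_lt, imp_iff_not_or]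
  rw [this]
  refine (isClosed_iInter fun k => ?_).inter (isClosed_iInter fun k => ?_)
  · exact (isClosed_le (by fun_prop) (by fun_prop)).union (isClosed_le (by fun_prop) (by fun_prop))
  · exact (isClosed_le (by fun_prop) (by fun_prop)).union (isClosed_le (by fun_prop) (by fun_prop))

/-- The constraint of `coarsen` at a grid line is exactly the bound needed, so adding points does
not move the threshold there. -/
lemma rightInf_coarsen (m : ℕ) (A : Set Square) (k : ℤ) :
    rightInf (coarsen m A) (k / m) = rightInf A (k / m) := by
  refine le_antisymm (sInf_le_sInf ?_) (le_sInf ?_)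
  · rintro y ⟨x, hx, h⟩; exact ⟨x, hx, subset_coarsen m A h⟩
  · rintro y ⟨x, hx, h⟩; exact h.1 k hx

lemma lowerSup_coarsen (m : ℕ) (A : Set Square) (k : ℤ) :
    lowerSup (coarsen m A) (k / m) = lowerSup A (k / m) := by
  refine le_antisymm (sSup_le ?_) (sSup_le_sSup ?_)
  · rintro y ⟨x, hx, h⟩; exact h.2 k hx
  · rintro y ⟨x, hx, h⟩; exact ⟨x, hx, subset_coarsen m A h⟩

/-- Each line `k/m` is the line `kc/(mc)` of the finer grid, where the finer coarsening preserves
the thresholds. -/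
lemma coarsen_coarsen {m c : ℕ} (hc : c ≠ 0) (A : Set Square) :
    coarsen m (coarsen (m * c) A) = coarsen m A := by
  have key (k : ℤ) : (k / m : ℝ) = (k * c : ℤ) / (m * c : ℕ) := by
    push_cast
    rw [mul_div_mul_right _ _ (by exact_mod_cast hc)]
  unfold coarsen
  simp only [key]
  have e1 := rightInf_coarsen (m * c) A
  have e2 := lowerSup_coarsen (m * c) A
  unfold coarsen at e1 e2
  simp only [e1, e2]

lemma coarsen_subset_coarsen {m c : ℕ} (hc : c ≠ 0) (A : Set Square) :
    coarsen (m * c) A ⊆ coarsen m A := by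
  exact (coarsen_coarsen (m := m) hc A) ▸ subset_coarsen m (coarsen (m * c) A)

/-- A region inside the upper-left triangle keeps away from the south-east corner when coarsened on
a grid with an interior line. -/
lemma corner_notMem_coarsen {A : Set Square} (htri : ∀ v ∈ A, v.1 ≤ v.2) {m : ℕ} (hm : 2 ≤ m) :
    ((1, 0) : Square) ∉ coarsen m A := by
  intro h
  have hm' : (2 : ℝ) ≤ m := by exact_mod_cast hm
  have h1 : (((1 : ℤ) : ℝ) / m) < ((1 : unitInterval) : ℝ) := by
    push_cast; rw [div_lt_one (by linarith)]; simp; linarith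
  have h2 := h.1 1 h1
  -- Points of `A` to the right of the line `1/m` lie above the diagonal, hence above height `1/m`.
  have h3 : (⟨1 / m, by positivity, by rw [div_le_one (by linarith)]; linarith⟩ : unitInterval) ≤
      rightInf A ((1 : ℤ) / m) := by
    refine le_sInf ?_
    rintro y ⟨x, hx, hA⟩
    refine Subtype.coe_le_coe.1 ?_
    have : (x : ℝ) ≤ y := htri _ hA
    push_cast at hx
    exact hx.le.trans this
  have h4 : (1 / m : ℝ) ≤ 0 := h3.trans h2
  have : 0 < (1 / m : ℝ) := by positivity
  linarith

/-! ### Boundaries and crossings -/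

lemma mem_boundary {M : Mechanism} {v : Square} :
    v ∈ M.boundary ↔ v ∈ M.alloc ∧ v ∈ closure M.allocᶜ := by
  simp only [Mechanism.boundary, Set.mem_ofPred_eq, Metric.mem_closure_iff]
  refine and_congr_right fun _ => forall₂_congr fun r _ => ?_
  simp only [Set.Nonempty, Set.mem_inter_iff, Metric.mem_ball, dist_comm]

lemma isClosed_boundary {M : Mechanism} (hA : IsClosed M.alloc) : IsClosed M.boundary := by
  have : M.boundary = M.alloc ∩ closure M.allocᶜ := by ext; exact mem_boundary
  rw [this]; exact hA.inter isClosed_closure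

/-- No point of an upward closed region lies strictly south-east of a boundary point. -/
lemma not_strict_of_mem_boundary {M : Mechanism} (hU : IsUpper M.alloc) {c w : Square}
    (hc : c ∈ M.boundary) (hw : w ∈ M.alloc) (h1 : c.1 < w.1) (h2 : w.2 < c.2) : False := by
  have hopen : IsOpen {u : Square | u.1 < w.1 ∧ w.2 < u.2} :=
    (isOpen_lt (by fun_prop) (by fun_prop)).inter (isOpen_lt (by fun_prop) (by fun_prop))
  obtain ⟨u, hu, hu'⟩ := mem_closure_iff.1 (mem_boundary.1 hc).2 _ hopen ⟨h1, h2⟩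
  exact hu' (hU hw ⟨hu.1.le, hu.2.le⟩)

lemma mem_closure_Ioi_of_lt_one {b : unitInterval} (h : b < 1) : b ∈ closure (Set.Ioi b) := by
  have : (Set.Ioi b).Nonempty := ⟨1, h⟩
  rw [closure_Ioi' this]; exact Set.mem_Ici.2 le_rfl

lemma mem_closure_Iio_of_pos {b : unitInterval} (h : 0 < b) : b ∈ closure (Set.Iio b) := by
  have : (Set.Iio b).Nonempty := ⟨0, h⟩
  rw [closure_Iio' this]; exact Set.mem_Iic.2 le_rfl

/-- The open quadrant south-east of `c` misses the region and accumulates at `c`. It is nonempty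
only if `c` is off the right and bottom sides, which therefore need separate care below. -/
lemma mem_boundary_of_strict {M : Mechanism} {c : Square} (hc : c ∈ M.alloc) (h1 : c.1 < 1)
    (h2 : 0 < c.2) (h : ∀ w ∈ M.alloc, c.1 < w.1 → ¬ w.2 < c.2) : c ∈ M.boundary := by
  refine mem_boundary.2 ⟨hc, ?_⟩
  have hsub : Set.Ioi c.1 ×ˢ Set.Iio c.2 ⊆ M.allocᶜ := fun w hw hA => h w hA hw.1 hw.2
  refine closure_mono hsub ?_
  rw [closure_prod_eq]
  exact ⟨mem_closure_Ioi_of_lt_one h1, mem_closure_Iio_of_pos h2⟩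

/-! ### The dyadic grid lines and the crossings on them -/

lemma prec_eq (h : ℕ) : prec h = 1 / ((2 ^ h : ℕ) : ℝ) := by simp [prec]

lemma mem_uniformPoints_iff {h : ℕ} {z : Square} : z ∈ uniformPoints (prec h) ↔
    ∃ i : ℕ, 1 ≤ i ∧ i ≤ 2 ^ h ∧ (z.1 : ℝ) = i / (2 ^ h : ℕ) ∧ (z.2 : ℝ) = i / (2 ^ h : ℕ) := by
  have : ⌊1 / prec h⌋₊ = 2 ^ h := by
    rw [prec_eq, one_div_one_div, Nat.floor_natCast]
  simp only [uniformPoints, Set.mem_ofPred_eq, this]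
  simp only [prec_eq, mul_one_div]

lemma exists_mem_uniformPoints {h : ℕ} {x : unitInterval} (k : ℤ)
    (hx : (x : ℝ) = k / (2 ^ h : ℕ)) : x = 0 ∨ (x, x) ∈ uniformPoints (prec h) := by
  have hpos : (0 : ℝ) < (2 ^ h : ℕ) := by positivity
  have h0 : (0 : ℝ) ≤ k := by
    have := x.2.1; rw [hx] at this
    by_contra! hk; exact absurd (div_neg_of_neg_of_pos hk hpos) (not_lt.2 this)
  have h1 : (k : ℝ) ≤ (2 ^ h : ℕ) := by
    have := x.2.2; rw [hx, div_le_one hpos] at this; exact this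
  lift k to ℕ using (by exact_mod_cast h0)
  rcases Nat.eq_zero_or_pos k with rfl | hk
  · left; ext; simpa using hx
  · right
    exact mem_uniformPoints_iff.2 ⟨k, hk, by exact_mod_cast h1, by simpa using hx, by simpa using hx⟩

lemma mem_gridX_uniformPoints {h : ℕ} {x : unitInterval} :
    x ∈ gridX (uniformPoints (prec h)) ↔ ∃ k : ℤ, (x : ℝ) = k / (2 ^ h : ℕ) := by
  have hpos : ((2 ^ h : ℕ) : ℝ) ≠ 0 := by positivity
  constructor
  · rintro ((rfl | rfl) | ⟨z, hz, rfl⟩)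
    · exact ⟨0, by simp⟩
    · exact ⟨(2 ^ h : ℕ), by rw [Int.cast_natCast, div_self hpos]; rfl⟩
    · obtain ⟨i, -, -, hi, -⟩ := mem_uniformPoints_iff.1 hz
      exact ⟨i, by simpa using hi⟩
  · rintro ⟨k, hk⟩
    rcases exists_mem_uniformPoints k hk with rfl | hx
    exacts [.inl (.inl rfl), .inr ⟨_, hx, rfl⟩]

lemma mem_gridY_uniformPoints {h : ℕ} {x : unitInterval} :
    x ∈ gridY (uniformPoints (prec h)) ↔ ∃ k : ℤ, (x : ℝ) = k / (2 ^ h : ℕ) := by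
  have hpos : ((2 ^ h : ℕ) : ℝ) ≠ 0 := by positivity
  constructor
  · rintro ((rfl | rfl) | ⟨z, hz, rfl⟩)
    · exact ⟨0, by simp⟩
    · exact ⟨(2 ^ h : ℕ), by rw [Int.cast_natCast, div_self hpos]; rfl⟩
    · obtain ⟨i, -, -, -, hi⟩ := mem_uniformPoints_iff.1 hz
      exact ⟨i, by simpa using hi⟩
  · rintro ⟨k, hk⟩
    rcases exists_mem_uniformPoints k hk with rfl | hx
    exacts [.inl (.inl rfl), .inr ⟨_, hx, rfl⟩]

lemma mem_crossings {M : Mechanism} {h : ℕ} {c : Square} : c ∈ M.crossings (prec h) ↔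
    c ∈ M.boundary ∧ ((∃ k : ℤ, (c.1 : ℝ) = k / (2 ^ h : ℕ)) ∨
      ∃ k : ℤ, (c.2 : ℝ) = k / (2 ^ h : ℕ)) := by
  simp only [Mechanism.crossings, gridSet, Set.mem_inter_iff, Set.mem_ofPred_eq,
    mem_gridX_uniformPoints, mem_gridY_uniformPoints]

lemma finite_uniformPoints (h : ℕ) : (uniformPoints (prec h)).Finite := by
  refine ((Set.finite_Iic (2 ^ h)).image fun i : ℕ =>
    (Set.projIcc (0 : ℝ) 1 zero_le_one (i / (2 ^ h : ℕ)),
      Set.projIcc (0 : ℝ) 1 zero_le_one (i / (2 ^ h : ℕ)))).subset fun z hz => ?_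
  obtain ⟨i, -, hi, h1, h2⟩ := mem_uniformPoints_iff.1 hz
  refine ⟨i, hi, Prod.ext ?_ ?_⟩
  · simp only [← h1]; exact Set.projIcc_val _ _
  · simp only [← h2]; exact Set.projIcc_val _ _

lemma isClosed_crossings {M : Mechanism} (hA : IsClosed M.alloc) (h : ℕ) :
    IsClosed (M.crossings (prec h)) := by
  have hX : (gridX (uniformPoints (prec h))).Finite :=
    (Set.toFinite _).union ((finite_uniformPoints h).image _)
  have hY : (gridY (uniformPoints (prec h))).Finite :=
    (Set.toFinite _).union ((finite_uniformPoints h).image _)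
  refine (isClosed_boundary hA).inter ?_
  exact (hX.isClosed.preimage continuous_fst).union (hY.isClosed.preimage continuous_snd)

/-! ### The region of the simplified mechanism -/

section Simplify

variable {M : Mechanism} (hA : IsClosed M.alloc) (hU : IsUpper M.alloc)
  (h01 : ((0, 1) : Square) ∈ M.alloc) (h10 : ((1, 0) : Square) ∉ M.alloc) {h : ℕ} {z : Square}
include hA hU

/-- If `z` violated the constraint at a grid line, the threshold point of `A` on that line would be
a crossing between `v` and `w` different from both. -/
lemma mem_coarsen_of_consecutive {v w : Square} (hvw : Consecutive (M.crossings (prec h)) v w)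
    (h1 : z.1 ≤ w.1) (h2 : v.2 ≤ z.2) : z ∈ coarsen (2 ^ h) M.alloc := by
  obtain ⟨hv, hw, hlt, hcons⟩ := hvw
  have hvA := (mem_boundary.1 (mem_crossings.1 hv).1).1
  have hwA := (mem_boundary.1 (mem_crossings.1 hw).1).1
  refine ⟨fun k hk => ?_, fun k hk => ?_⟩
  · by_contra! hT
    generalize hξ : (k / (2 ^ h : ℕ) : ℝ) = ξ at hk hT
    have hv1 : (v.1 : ℝ) ≤ ξ := by
      by_contra! hlt'
      exact absurd ((rightInf_le hvA hlt').trans h2) (not_le.2 hT)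
    obtain ⟨x, rfl⟩ : ∃ x : unitInterval, (x : ℝ) = ξ :=
      ⟨⟨ξ, v.1.2.1.trans hv1, hk.le.trans z.1.2.2⟩, rfl⟩
    have hxw : x < w.1 := lt_of_lt_of_le hk h1
    have hc : (x, rightInf M.alloc x) ∈ M.crossings (prec h) := by
      refine mem_crossings.2 ⟨mem_boundary_of_strict (rightInf_mem hA hU hwA hxw) ?_ ?_ ?_,
        .inl ⟨k, hξ.symm⟩⟩
      · exact lt_of_lt_of_le hxw w.1.2.2
      · exact lt_of_le_of_lt z.2.2.1 hT
      · intro u hu hu1 hu2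
        exact absurd (rightInf_le hu hu1) (not_le.2 hu2)
    rcases hcons _ hc ⟨hv1, h2.trans hT.le⟩ ⟨hxw.le, rightInf_le hwA hxw⟩ with e | e
    · exact absurd (h2.trans_lt hT) (by rw [← e]; exact lt_irrefl _)
    · exact absurd hxw (by rw [← e]; exact lt_irrefl _)
  · by_contra! hT
    generalize hξ : (k / (2 ^ h : ℕ) : ℝ) = η at hk hT
    have hw2 : η ≤ w.2 := by
      by_contra! hlt'
      exact absurd (h1.trans (le_lowerSup hwA hlt')) (not_le.2 hT)
    obtain ⟨y, rfl⟩ : ∃ y : unitInterval, (y : ℝ) = η :=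
      ⟨⟨η, z.2.2.1.trans hk.le, hw2.trans w.2.2.2⟩, rfl⟩
    have hvy : v.2 < y := lt_of_le_of_lt h2 hk
    have hc : (lowerSup M.alloc y, y) ∈ M.crossings (prec h) := by
      refine mem_crossings.2 ⟨mem_boundary_of_strict (lowerSup_mem hA hU hvA hvy) ?_ ?_ ?_,
        .inr ⟨k, hξ.symm⟩⟩
      · exact lt_of_lt_of_le hT z.1.2.2
      · exact lt_of_le_of_lt v.2.2.1 hvy
      · intro u hu hu1 hu2
        exact absurd (le_lowerSup hu hu2) (not_le.2 hu1)
    rcases hcons _ hc ⟨le_lowerSup hvA hvy, hvy.le⟩ ⟨hT.le.trans h1, hw2⟩ with e | e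
    · exact absurd hvy (by rw [← e]; exact lt_irrefl _)
    · exact absurd (hT.trans_le h1) (by rw [← e]; exact lt_irrefl _)

include h01 h10

/-- The line `k = -1` lies left of the whole square, so its constraint bounds `z.2` below by the
lowest ordinate `a` of the region. The crossing is where the boundary leaves the square: `(0, a)`,
or a point of the bottom side if `a = 0`; the excluded corner `(1, 0)` keeps the latter off the
corner. -/
lemma exists_crossing_below (hz : z ∈ coarsen (2 ^ h) M.alloc) :
    ∃ c ∈ M.crossings (prec h), c.2 ≤ z.2 := by
  have hpos : (0 : ℝ) < (2 ^ h : ℕ) := by positivity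
  have hneg : (((-1 : ℤ) : ℝ) / (2 ^ h : ℕ)) < 0 := div_neg_of_neg_of_pos (by norm_num) hpos
  have ha : rightInf M.alloc (((-1 : ℤ) : ℝ) / (2 ^ h : ℕ)) ≤ z.2 :=
    hz.1 (-1) (hneg.trans_le z.1.2.1)
  set a := sInf {y | ((0 : unitInterval), y) ∈ M.alloc}
  have haA : (0, a) ∈ M.alloc := sInf_vertical_mem hA h01
  have hle (w : Square) (hw : w ∈ M.alloc) : a ≤ w.2 :=
    sInf_le (hU hw ⟨w.1.2.1, le_rfl⟩)
  have haz : a ≤ z.2 := by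
    refine le_trans (le_sInf ?_) ha
    rintro y ⟨x, -, hx⟩; exact hle _ hx
  rcases eq_or_lt_of_le (show 0 ≤ a from a.2.1) with h0 | h0
  · rw [← h0] at haA
    have hb := sSup_horizontal_mem hA haA
    set b := sSup {x | (x, (0 : unitInterval)) ∈ M.alloc}
    have hb1 : b < 1 := by
      refine lt_of_le_of_ne b.2.2 fun e => h10 ?_
      rw [← e]; exact hb
    refine ⟨(b, 0), mem_crossings.2 ⟨mem_boundary.2 ⟨hb, ?_⟩, .inr ⟨0, by simp⟩⟩, z.2.2.1⟩
    have hsub : Set.Ioi b ×ˢ {(0 : unitInterval)} ⊆ M.allocᶜ := by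
      rintro ⟨x, y⟩ ⟨hx, rfl⟩ hx'
      exact absurd (show x ≤ b from le_sSup hx') (not_le.2 hx)
    refine closure_mono hsub ?_
    rw [closure_prod_eq]
    exact ⟨mem_closure_Ioi_of_lt_one hb1, subset_closure rfl⟩
  · refine ⟨(0, a), mem_crossings.2 ⟨mem_boundary_of_strict haA ?_ h0 ?_, .inl ⟨0, by simp⟩⟩, haz⟩
    · exact zero_lt_one
    · intro w hw _ h'; exact absurd (hle w hw) (not_le.2 h')

/-- Mirror image of `exists_crossing_below`: the line `k = 2^h + 1` lies above the square and bounds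
`z.1` by the largest abscissa of the region. -/
lemma exists_crossing_right (hz : z ∈ coarsen (2 ^ h) M.alloc) :
    ∃ c ∈ M.crossings (prec h), z.1 ≤ c.1 := by
  have hpos : (0 : ℝ) < (2 ^ h : ℕ) := by positivity
  have hbig : (1 : ℝ) < (((2 ^ h : ℕ) + 1 : ℤ) : ℝ) / (2 ^ h : ℕ) := by
    rw [lt_div_iff₀ hpos]; push_cast; linarith
  have ha := hz.2 _ (lt_of_le_of_lt z.2.2.2 hbig)
  set b := sSup {x | (x, (1 : unitInterval)) ∈ M.alloc}
  have hbA : (b, 1) ∈ M.alloc := sSup_horizontal_mem hA h01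
  have hle (w : Square) (hw : w ∈ M.alloc) : w.1 ≤ b :=
    le_sSup (hU hw ⟨le_rfl, w.2.2.2⟩)
  have hbz : z.1 ≤ b := by
    refine ha.trans (sSup_le ?_)
    rintro x ⟨y, -, hx⟩; exact hle _ hx
  have hone : ∃ k : ℤ, ((1 : unitInterval) : ℝ) = k / (2 ^ h : ℕ) :=
    ⟨(2 ^ h : ℕ), by rw [Int.cast_natCast, div_self hpos.ne']; rfl⟩
  rcases eq_or_lt_of_le (show b ≤ 1 from b.2.2) with h0 | h0
  · rw [h0] at hbA
    have hb := sInf_vertical_mem hA hbA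
    set a := sInf {y | ((1 : unitInterval), y) ∈ M.alloc}
    have ha0 : 0 < a := by
      refine lt_of_le_of_ne a.2.1 fun e => h10 ?_
      have e' : (0 : unitInterval) = a := e
      rw [e']; exact hb
    refine ⟨(1, a), mem_crossings.2 ⟨mem_boundary.2 ⟨hb, ?_⟩, .inl hone⟩, z.1.2.2⟩
    have hsub : {(1 : unitInterval)} ×ˢ Set.Iio a ⊆ M.allocᶜ := by
      rintro ⟨x, y⟩ ⟨rfl, hx⟩ hx'
      exact absurd (show a ≤ y from sInf_le hx') (not_le.2 hx)
    refine closure_mono hsub ?_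
    rw [closure_prod_eq]
    exact ⟨subset_closure rfl, mem_closure_Iio_of_pos ha0⟩
  · refine ⟨(b, 1), mem_crossings.2 ⟨mem_boundary_of_strict hbA h0 ?_ ?_, .inr hone⟩, hbz⟩
    · exact zero_lt_one
    · intro w hw h' _; exact absurd (hle w hw) (not_le.2 h')

/-- A point of the coarsening that dominates no crossing lies between the last crossing below it and
the first crossing to its right. These are consecutive, and the point dominates the corner of the
path between them. -/
lemma upRegion_simplePath : upRegion (M.simplePath (prec h)) = coarsen (2 ^ h) M.alloc := by
  apply Set.Subset.antisymm
  · rintro z ⟨c, hc | ⟨v, w, hvw, hc | hc⟩, hzc⟩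
    · exact subset_coarsen _ _ (hU (mem_boundary.1 (mem_crossings.1 hc).1).1 hzc)
    · exact mem_coarsen_of_consecutive hA hU hvw (hzc.1.trans hc.2.1) (hc.1.2.trans hzc.2)
    · exact mem_coarsen_of_consecutive hA hU hvw (hzc.1.trans hc.2.1) (hc.1.2.trans hzc.2)
  · intro z hz
    by_cases hdom : ∃ c ∈ M.crossings (prec h), Dominates z c
    · obtain ⟨c, hc, hzc⟩ := hdom
      exact ⟨c, .inl hc, hzc⟩
    push Not at hdom
    have hK := isClosed_crossings hA h
    -- The coordinate sum is strictly increasing for the product order, so its extrema over compact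
    -- sets of crossings pick out the last and the first crossing.
    have hφ : Continuous fun c : Square => (c.1 : ℝ) + c.2 := by fun_prop
    have hB : IsCompact (M.crossings (prec h) ∩ {c | c.2 ≤ z.2}) :=
      (hK.inter (isClosed_le (by fun_prop) (by fun_prop))).isCompact
    have hC : IsCompact (M.crossings (prec h) ∩ {c | z.1 ≤ c.1}) :=
      (hK.inter (isClosed_le (by fun_prop) (by fun_prop))).isCompact
    obtain ⟨v, ⟨hv, hv2⟩, hvmax⟩ :=
      hB.exists_isMaxOn (exists_crossing_below hA hU h01 h10 hz) hφ.continuousOn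
    obtain ⟨w, ⟨hw, hw1⟩, hwmin⟩ :=
      hC.exists_isMinOn (exists_crossing_right hA hU h01 h10 hz) hφ.continuousOn
    have hv1 : v.1 < z.1 := by by_contra! h'; exact hdom v hv ⟨h', hv2⟩
    have hw2 : z.2 < w.2 := by by_contra! h'; exact hdom w hw ⟨hw1, h'⟩
    have hvw : v < w := Prod.lt_iff.2 (.inl ⟨hv1.trans_le hw1, hv2.trans hw2.le⟩)
    have heq {c d : Square} (hcd : c ≤ d) (hs : (d.1 : ℝ) + d.2 ≤ c.1 + c.2) : c = d := by
      have e1 : (c.1 : ℝ) ≤ d.1 := hcd.1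
      have e2 : (c.2 : ℝ) ≤ d.2 := hcd.2
      exact Prod.ext (Subtype.ext (by linarith)) (Subtype.ext (by linarith))
    refine ⟨(w.1, v.2), .inr ⟨v, w, ⟨hv, hw, hvw, fun c hc hvc hcw => ?_⟩,
      .inl ⟨⟨hvw.le.1, le_rfl⟩, le_rfl⟩⟩, hw1, hv2⟩
    by_cases hcB : c.2 ≤ z.2
    · exact .inl (heq hvc (hvmax ⟨hc, hcB⟩)).symm
    by_cases hcC : z.1 ≤ c.1
    · exact .inr (heq hcw (hwmin ⟨hc, hcC⟩))
    exfalso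
    push Not at hcB hcC
    -- Here `c` is strictly north-west of `z`. The constraint on `z` at the grid line through `c`
    -- yields a point of the region strictly south-east of the boundary point `c`.
    obtain ⟨hcb, ⟨k, hk⟩ | ⟨k, hk⟩⟩ := mem_crossings.1 hc
    · have h1 := hz.1 k (by rw [← hk]; exact hcC)
      rw [← hk] at h1
      obtain ⟨u, hu, hu1, hu2⟩ := exists_of_rightInf_lt (h1.trans_lt hcB)
      exact not_strict_of_mem_boundary hU hcb hu hu1 hu2
    · have h1 := hz.2 k (by rw [← hk]; exact hcB)
      rw [← hk] at h1
      obtain ⟨u, hu, hu1, hu2⟩ := exists_of_lt_lowerSup (hcC.trans_le h1)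
      exact not_strict_of_mem_boundary hU hcb hu hu2 hu1

lemma approx_eq_myerson : approx h M = myerson (coarsen (2 ^ h) M.alloc) := by
  rw [approx, Mechanism.simplify, upRegion_simplePath hA hU h01 h10]

end Simplify

/-! ### Profit loss under coarsening -/

lemma exists_grid_lt_le {m : ℕ} (hm : 0 < m) (x : ℝ) :
    ∃ k : ℤ, (k / m : ℝ) < x ∧ x ≤ k / m + 1 / m := by
  have hm' : (0 : ℝ) < m := by exact_mod_cast hm
  refine ⟨⌈x * m⌉ - 1, ?_, ?_⟩
  · rw [div_lt_iff₀ hm']; push_cast; linarith [Int.ceil_lt_add_one (x * m)]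
  · rw [← add_div, le_div_iff₀ hm']; push_cast; linarith [Int.le_ceil (x * m)]

section Profit

variable {A B : Set Square} (hA : IsClosed A) (hU : IsUpper A) {m : ℕ} (hm : 0 < m)

lemma profit_myerson_antitone_on (hAB : A ⊆ B) {v : Square} (hv : v ∈ A) :
    (myerson B).profit v ≤ (myerson A).profit v := by
  have hvB := hAB hv
  have h1 : sInf {y | (v.1, y) ∈ B} ≤ sInf {y | (v.1, y) ∈ A} := sInf_le_sInf fun y hy => hAB hy
  have h2 : sSup {x | (x, v.2) ∈ A} ≤ sSup {x | (x, v.2) ∈ B} := sSup_le_sSup fun y hy => hAB hy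
  rw [← myerson_charge_of_mem hv, ← myerson_charge_of_mem hvB] at h1
  rw [← myerson_pay_of_mem hv, ← myerson_pay_of_mem hvB] at h2
  have h1 : ((myerson B).charge v : ℝ) ≤ (myerson A).charge v := h1
  have h2 : ((myerson A).pay v : ℝ) ≤ (myerson B).pay v := h2
  unfold Mechanism.profit; linarith

include hA hU hm

/-- Where `A` trades, coarsening costs at most twice the mesh. -/
lemma profit_sub_le_profit_coarsen {v : Square} (hv : v ∈ A) :
    (myerson A).profit v - 2 / m ≤ (myerson (coarsen m A)).profit v := by
  have hm' : (0 : ℝ) < m := by exact_mod_cast hm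
  have hvB := subset_coarsen m A hv
  have hq := sInf_vertical_mem (isClosed_coarsen m A) hvB
  have hp := sSup_horizontal_mem (isClosed_coarsen m A) hvB
  have hq1 : ((sInf {y | (v.1, y) ∈ A} : unitInterval) : ℝ) - 1 / m ≤
      (sInf {y | (v.1, y) ∈ coarsen m A} : unitInterval) := by
    set q := sInf {y | (v.1, y) ∈ A}
    set y := sInf {y | (v.1, y) ∈ coarsen m A}
    by_contra! hlt
    -- The price gap exceeds the mesh, so a grid line separates the two prices. On that line the
    -- coarsening imposes the constraint of `A` itself.
    obtain ⟨k, hk1, hk2⟩ := exists_grid_lt_le hm (q : ℝ)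
    have hyk : (y : ℝ) < k / m := by linarith
    have hL := hq.2 k hyk
    obtain ⟨η, hη⟩ : ∃ η : unitInterval, (η : ℝ) = k / m :=
      ⟨⟨k / m, y.2.1.trans hyk.le, hk1.le.trans q.2.2⟩, rfl⟩
    rw [← hη] at hL hyk hk1
    -- some point of `A` lies strictly below `η`
    have hw : ∃ w ∈ A, w.2 < η := by
      by_contra! hno
      -- An empty supremum is `0`, which would put `v` on the left side. The constraint at `k = -1`
      -- then still produces a point of `A` below `η`.
      have h0 : lowerSup A η = 0 := by
        refine le_antisymm (sSup_le ?_) (lowerSup A η).2.1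
        rintro x ⟨y', hy', hx⟩
        exact absurd (hno _ hx) (not_le.2 hy')
      have hv0 : v.1 = 0 := le_antisymm (hL.trans h0.le) v.1.2.1
      have hneg : (((-1 : ℤ) : ℝ) / m) < 0 := div_neg_of_neg_of_pos (by norm_num) hm'
      have ha := hq.1 (-1) (hneg.trans_le v.1.2.1)
      obtain ⟨w, hw, -, hw2⟩ := exists_of_rightInf_lt (ha.trans_lt hyk)
      exact absurd (hno w hw) (not_le.2 hw2)
    obtain ⟨w, hw, hwη⟩ := hw
    have hmem : (v.1, η) ∈ A := hU (lowerSup_mem hA hU hw hwη) ⟨hL, le_rfl⟩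
    have : q ≤ η := sInf_le hmem
    exact absurd this (not_le.2 hk1)
  have hp1 : ((sSup {x | (x, v.2) ∈ coarsen m A} : unitInterval) : ℝ) - 1 / m ≤
      (sSup {x | (x, v.2) ∈ A} : unitInterval) := by
    set p := sSup {x | (x, v.2) ∈ A}
    set x := sSup {x | (x, v.2) ∈ coarsen m A}
    by_contra! hlt
    obtain ⟨k, hk1, hk2⟩ := exists_grid_lt_le hm (x : ℝ)
    have hT := hp.1 k hk1
    have hpk : (p : ℝ) < k / m := by linarith
    obtain ⟨ξ, hξ⟩ : ∃ ξ : unitInterval, (ξ : ℝ) = k / m :=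
      ⟨⟨k / m, p.2.1.trans hpk.le, hk1.le.trans x.2.2⟩, rfl⟩
    rw [← hξ] at hT hpk hk1
    have hw : ∃ w ∈ A, ξ < w.1 := by
      by_contra! hno
      have h0 : rightInf A ξ = 1 := by
        refine le_antisymm (rightInf A ξ).2.2 (le_sInf ?_)
        rintro y ⟨x', hx', hx⟩
        exact absurd (hno _ hx) (not_le.2 hx')
      have hv0 : v.2 = 1 := le_antisymm v.2.2.2 (h0.ge.trans hT)
      have hbig : (1 : ℝ) < (((m : ℤ) + 1 : ℤ) : ℝ) / m := by
        rw [lt_div_iff₀ hm']; push_cast; linarith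
      have ha := hp.2 _ (v.2.2.2.trans_lt hbig)
      obtain ⟨w, hw, -, hw2⟩ := exists_of_lt_lowerSup (lt_of_lt_of_le hk1 ha)
      exact absurd (hno w hw) (not_le.2 hw2)
    obtain ⟨w, hw, hwη⟩ := hw
    have hmem : (ξ, v.2) ∈ A := hU (rightInf_mem hA hU hw hwη) ⟨le_rfl, hT⟩
    have : ξ ≤ p := le_sSup hmem
    exact absurd this (not_le.2 hpk)
  rw [← myerson_charge_of_mem hv, ← myerson_charge_of_mem hvB] at hq1
  rw [← myerson_pay_of_mem hv, ← myerson_pay_of_mem hvB] at hp1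
  have : (2 / m : ℝ) = 1 / m + 1 / m := by ring
  unfold Mechanism.profit; linarith

/-- Where coarsening adds trades, each of these costs at most twice the mesh. -/
lemma neg_le_profit_coarsen (htri : ∀ v ∈ A, v.1 ≤ v.2) {v : Square} (hvA : v ∉ A) :
    -(2 / m : ℝ) ≤ (myerson (coarsen m A)).profit v := by
  have hm' : (0 : ℝ) < m := by exact_mod_cast hm
  by_cases hvB : v ∈ coarsen m A
  swap
  · rw [profit_of_notMem (M := myerson (coarsen m A)) hvB]
    have : (0 : ℝ) ≤ 2 / m := by positivity
    linarith
  have hq := sInf_vertical_mem (isClosed_coarsen m A) hvB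
  have hp := sSup_horizontal_mem (isClosed_coarsen m A) hvB
  rw [← myerson_charge_of_mem hvB] at hq
  rw [← myerson_pay_of_mem hvB] at hp
  set y := (myerson (coarsen m A)).charge v
  set x := (myerson (coarsen m A)).pay v
  obtain ⟨i, hi1, hi2⟩ := exists_grid_lt_le hm (v.1 : ℝ)
  obtain ⟨j, hj1, hj2⟩ := exists_grid_lt_le hm (y : ℝ)
  -- the seller's payment does not pass the grid line to the right of `v`
  have hx : (x : ℝ) ≤ i / m + 1 / m := by
    by_contra! hlt
    have hT := hp.1 (i + 1) (by push_cast; rw [add_div]; exact hlt)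
    push_cast at hT
    rw [add_div] at hT
    obtain ⟨ξ, hξ⟩ : ∃ ξ : unitInterval, (ξ : ℝ) = i / m + 1 / m :=
      ⟨⟨i / m + 1 / m, v.1.2.1.trans hi2, hlt.le.trans x.2.2⟩, rfl⟩
    rw [← hξ] at hT hi2 hlt
    by_cases hw : ∃ w ∈ A, ξ < w.1
    · obtain ⟨w, hw, hwξ⟩ := hw
      exact hvA (hU (rightInf_mem hA hU hw hwξ) ⟨hi2, hT⟩)
    · push Not at hw
      have hbig : (1 : ℝ) < (((m : ℤ) + 1 : ℤ) : ℝ) / m := by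
        rw [lt_div_iff₀ hm']; push_cast; linarith
      have ha := hp.2 _ (v.2.2.2.trans_lt hbig)
      obtain ⟨w, hw', -, hw2⟩ := exists_of_lt_lowerSup (lt_of_lt_of_le hlt ha)
      exact absurd (hw w hw') (not_le.2 hw2)
  have hy : (v.2 : ℝ) ≤ y + 1 / m := by
    by_contra! hlt
    obtain ⟨k, hk1, hk2⟩ := exists_grid_lt_le hm (v.2 : ℝ)
    have hyk : (y : ℝ) < k / m := by linarith
    have hL := hq.2 k hyk
    obtain ⟨η, hη⟩ : ∃ η : unitInterval, (η : ℝ) = k / m :=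
      ⟨⟨k / m, y.2.1.trans hyk.le, hk1.le.trans v.2.2.2⟩, rfl⟩
    rw [← hη] at hL hyk hk1
    by_cases hw : ∃ w ∈ A, w.2 < η
    · obtain ⟨w, hw, hwη⟩ := hw
      exact hvA (hU (lowerSup_mem hA hU hw hwη) ⟨hL, hk1.le⟩)
    · push Not at hw
      have hneg : (((-1 : ℤ) : ℝ) / m) < 0 := div_neg_of_neg_of_pos (by norm_num) hm'
      have ha := hq.1 (-1) (hneg.trans_le v.1.2.1)
      obtain ⟨w, hw', -, hw2⟩ := exists_of_rightInf_lt (ha.trans_lt hyk)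
      exact absurd (hw w hw') (not_le.2 hw2)
  -- Otherwise `A` would have a point right of and below `(i/m, i/m)`, that is, below the diagonal.
  have hdiag : (i / m : ℝ) ≤ v.2 := by
    have hT := hvB.1 i hi1
    by_contra! hlt
    obtain ⟨ξ, hξ⟩ : ∃ ξ : unitInterval, (ξ : ℝ) = i / m :=
      ⟨⟨i / m, v.2.2.1.trans hlt.le, hi1.le.trans v.1.2.2⟩, rfl⟩
    rw [← hξ] at hlt hT
    obtain ⟨w, hw, hw1, hw2⟩ := exists_of_rightInf_lt (hT.trans_lt hlt)
    exact absurd (htri w hw) (not_le.2 (lt_trans hw2 hw1))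
  have : (2 / m : ℝ) = 1 / m + 1 / m := by ring
  have : (myerson (coarsen m A)).profit v = y - x := rfl
  linarith

lemma profit_sub_le_profit_coarsen_of_triangle (htri : ∀ v ∈ A, v.1 ≤ v.2) (v : Square) :
    (myerson A).profit v - 2 / m ≤ (myerson (coarsen m A)).profit v := by
  by_cases hv : v ∈ A
  · exact profit_sub_le_profit_coarsen hA hU hm hv
  · rw [profit_of_notMem (M := myerson A) hv]
    linarith [neg_le_profit_coarsen hA hU hm htri hv]

/-- The finer coarsening may leave the triangle, so it serves as the base region only where it
trades; elsewhere `A` does not trade either and the loss bound relative to `A` applies. -/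
lemma neg_le_profit_coarsen_sub (htri : ∀ v ∈ A, v.1 ≤ v.2) {c : ℕ} (hc : c ≠ 0) (v : Square) :
    -(2 / m : ℝ) ≤ (myerson (coarsen m A)).profit v - (myerson (coarsen (m * c) A)).profit v := by
  by_cases hv : v ∈ coarsen (m * c) A
  · have := profit_sub_le_profit_coarsen (isClosed_coarsen (m * c) A) (isUpper_coarsen _ A) hm hv
    rw [coarsen_coarsen hc] at this
    linarith
  · rw [profit_of_notMem (M := myerson (coarsen (m * c) A)) hv]
    have := neg_le_profit_coarsen hA hU hm htri fun h => hv (subset_coarsen _ _ h)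
    linarith

-- On the finer region the larger, coarser one pays more and charges less; off it the finer profit
-- is `0`.
omit hA hU hm in
lemma profit_coarsen_sub_le_one {c : ℕ} (hc : c ≠ 0) (v : Square) :
    (myerson (coarsen m A)).profit v - (myerson (coarsen (m * c) A)).profit v ≤ 1 := by
  by_cases hv : v ∈ coarsen (m * c) A
  · have := profit_myerson_antitone_on (coarsen_subset_coarsen (m := m) hc A) hv
    linarith
  · rw [profit_of_notMem (M := myerson (coarsen (m * c) A)) hv, sub_zero]
    exact profit_le_one _ _

end Profit

/-! ### Parametrized regions -/

/-- A region cut out by finitely many thresholds, for the knots `(s - 1) / m` and `(s + 1) / m`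
with `0 ≤ s ≤ m`; only one coordinate of each parameter matters. -/
def thresholdRegion (m : ℕ) (θ : Fin (m + 1) ⊕ Fin (m + 1) → Square) : Set Square :=
  {z | (∀ s : Fin (m + 1), (((s : ℕ) : ℝ) - 1) / m < z.1 → (θ (.inl s)).2 ≤ z.2) ∧
    ∀ s : Fin (m + 1), (z.2 : ℝ) < (((s : ℕ) : ℝ) + 1) / m → z.1 ≤ (θ (.inr s)).1}

lemma rightInf_of_neg (A : Set Square) {ξ : ℝ} (hξ : ξ < 0) :
    rightInf A ξ = sInf {y | ∃ x, (x, y) ∈ A} := by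
  unfold rightInf; congr 1; ext y
  exact ⟨fun ⟨x, _, h⟩ => ⟨x, h⟩, fun ⟨x, h⟩ => ⟨x, hξ.trans_le x.2.1, h⟩⟩

lemma lowerSup_of_one_lt (A : Set Square) {η : ℝ} (hη : 1 < η) :
    lowerSup A η = sSup {x | ∃ y, (x, y) ∈ A} := by
  unfold lowerSup; congr 1; ext y
  exact ⟨fun ⟨x, _, h⟩ => ⟨x, h⟩, fun ⟨x, h⟩ => ⟨x, x.2.2.trans_lt hη, h⟩⟩

/-- Finitely many knots suffice: all negative `k` impose the same condition, as do all `k > m`,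
while a right threshold with `k ≥ m` or a lower one with `k ≤ 0` is vacuous. -/
lemma coarsen_eq_thresholdRegion {m : ℕ} (hm : 0 < m) {A : Set Square}
    {θ : Fin (m + 1) ⊕ Fin (m + 1) → Square}
    (hl : ∀ s : Fin (m + 1), (θ (.inl s)).2 = rightInf A ((((s : ℕ) : ℝ) - 1) / m))
    (hr : ∀ s : Fin (m + 1), (θ (.inr s)).1 = lowerSup A ((((s : ℕ) : ℝ) + 1) / m)) :
    coarsen m A = thresholdRegion m θ := by
  have hm' : (0 : ℝ) < m := by exact_mod_cast hm
  ext z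
  refine ⟨fun hz => ⟨fun s hs => ?_, fun s hs => ?_⟩, fun hz => ⟨fun k hk => ?_, fun k hk => ?_⟩⟩
  · rw [hl]
    have := hz.1 ((s : ℕ) - 1)
    push_cast at this
    exact this hs
  · rw [hr]
    have := hz.2 ((s : ℕ) + 1)
    push_cast at this
    exact this hs
  · have hkm : k < m := by
      have := hk.trans_le z.1.2.2
      rw [div_lt_one hm'] at this
      exact_mod_cast this
    rcases lt_or_ge k 0 with h0 | h0
    · have hneg : (((0 : ℕ) : ℝ) - 1) / m < 0 := div_neg_of_neg_of_pos (by norm_num) hm'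
      have h := hz.1 0 (lt_of_lt_of_le hneg z.1.2.1)
      rw [hl] at h
      rw [Fin.val_zero, rightInf_of_neg A hneg] at h
      rwa [rightInf_of_neg A (div_neg_of_neg_of_pos (by exact_mod_cast h0) hm')]
    · lift k to ℕ using h0
      have e : (((k + 1 : ℕ) : ℝ) - 1) / m = ((k : ℤ) : ℝ) / m := by push_cast; ring
      have h := hz.1 ⟨k + 1, by omega⟩
      rw [hl] at h
      simp only [e] at h
      exact h hk
  · have hk0 : 0 < k := by
      have := z.2.2.1.trans_lt hk
      have := (div_pos_iff_of_pos_right hm').1 this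
      exact_mod_cast this
    rcases lt_or_ge (m : ℤ) k with h0 | h0
    · have hbig : 1 < (((m : ℕ) : ℝ) + 1) / m := by rw [lt_div_iff₀ hm']; linarith
      have h := hz.2 (Fin.last m) (lt_of_le_of_lt z.2.2.2 hbig)
      rw [hr] at h
      rw [Fin.val_last, lowerSup_of_one_lt A hbig] at h
      rwa [lowerSup_of_one_lt A]
      rw [lt_div_iff₀ hm', one_mul]; exact_mod_cast h0
    · obtain ⟨s, rfl⟩ : ∃ s : ℕ, k = s + 1 := ⟨(k - 1).toNat, by omega⟩
      have h := hz.2 ⟨s, by omega⟩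
      rw [hr] at h
      push_cast at hk ⊢
      exact h hk

/-- The buyer's Myerson payment, as a finite supremum. -/
noncomputable def thresholdCharge (m : ℕ) (θ : Fin (m + 1) ⊕ Fin (m + 1) → Square) (v : Square) :
    unitInterval :=
  (⨆ s : Fin (m + 1), if (((s : ℕ) : ℝ) - 1) / m < v.1 then (θ (.inl s)).2 else 0) ⊔
  ⨆ s : Fin (m + 1), if (θ (.inr s)).1 < v.1 then
    Set.projIcc (0 : ℝ) 1 zero_le_one ((((s : ℕ) : ℝ) + 1) / m) else 0

/-- The seller's Myerson payment, as a finite infimum. -/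
noncomputable def thresholdPay (m : ℕ) (θ : Fin (m + 1) ⊕ Fin (m + 1) → Square) (v : Square) :
    unitInterval :=
  (⨅ s : Fin (m + 1), if (v.2 : ℝ) < (((s : ℕ) : ℝ) + 1) / m then (θ (.inr s)).1 else 1) ⊓
  ⨅ s : Fin (m + 1), if v.2 < (θ (.inl s)).2 then
    Set.projIcc (0 : ℝ) 1 zero_le_one ((((s : ℕ) : ℝ) - 1) / m) else 1

section Threshold

variable {m : ℕ} {θ : Fin (m + 1) ⊕ Fin (m + 1) → Square} {v : Square}

lemma charge_thresholdRegion (hv : v ∈ thresholdRegion m θ) :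
    (myerson (thresholdRegion m θ)).charge v = thresholdCharge m θ v := by
  rw [myerson_charge_of_mem hv]
  suffices h : {y | (v.1, y) ∈ thresholdRegion m θ} = Set.Ici (thresholdCharge m θ v) by
    rw [h]; exact csInf_Ici
  ext y
  simp only [Set.mem_Ici, thresholdCharge, sup_le_iff, iSup_le_iff]
  refine and_congr (forall_congr' fun s => ?_) (forall_congr' fun s => ?_)
  · split_ifs with h
    · exact ⟨fun h' => h' h, fun h' _ => h'⟩
    · exact ⟨fun _ => y.2.1, fun _ h' => absurd h' h⟩
  · split_ifs with h
    · have h1 : ((((s : ℕ) : ℝ) + 1) / m) ≤ v.2 := by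
        by_contra! h'; exact absurd (hv.2 s h') (not_le.2 h)
      have h0 : (0 : ℝ) ≤ (((s : ℕ) : ℝ) + 1) / m := by positivity
      rw [Set.projIcc_of_mem zero_le_one ⟨h0, h1.trans v.2.2.2⟩]
      refine ⟨fun h' => ?_, fun h' h'' => absurd h'' (not_lt.2 h')⟩
      by_contra! h''
      exact absurd (h' h'') (not_le.2 h)
    · exact ⟨fun _ => y.2.1, fun _ _ => not_lt.1 h⟩

lemma pay_thresholdRegion (hv : v ∈ thresholdRegion m θ) :
    (myerson (thresholdRegion m θ)).pay v = thresholdPay m θ v := by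
  rw [myerson_pay_of_mem hv]
  suffices h : {x | (x, v.2) ∈ thresholdRegion m θ} = Set.Iic (thresholdPay m θ v) by
    rw [h]; exact csSup_Iic
  ext x
  simp only [Set.mem_Iic, thresholdPay, le_inf_iff, le_iInf_iff]
  rw [and_comm (a := ∀ s : Fin (m + 1), _)]
  refine and_congr (forall_congr' fun s => ?_) (forall_congr' fun s => ?_)
  · split_ifs with h
    · have h1 : (v.1 : ℝ) ≤ ((((s : ℕ) : ℝ) - 1) / m) := by
        by_contra! h'; exact absurd (hv.1 s h') (not_le.2 h)
      have h0 : (((s : ℕ) : ℝ) - 1) / m ≤ 1 := by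
        refine div_le_one_of_le₀ ?_ (by positivity)
        have : (((s : ℕ) : ℝ)) < m + 1 := by exact_mod_cast s.2
        linarith
      rw [Set.projIcc_of_mem zero_le_one ⟨v.1.2.1.trans h1, h0⟩]
      refine ⟨fun h' => ?_, fun h' h'' => absurd h'' (not_lt.2 h')⟩
      by_contra! h''
      exact absurd (h' h'') (not_le.2 h)
    · exact ⟨fun _ => x.2.2, fun _ _ => not_lt.1 h⟩
  · split_ifs with h
    · exact ⟨fun h' => h' h, fun h' _ => h'⟩
    · exact ⟨fun _ => x.2.2, fun _ h' => absurd h' h⟩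

end Threshold

lemma measurable_profit_thresholdRegion (m : ℕ) :
    Measurable fun p : (Fin (m + 1) ⊕ Fin (m + 1) → Square) × Square =>
      (myerson (thresholdRegion m p.1)).profit p.2 := by
  classical
  have hmem : MeasurableSet {p : (Fin (m + 1) ⊕ Fin (m + 1) → Square) × Square |
      p.2 ∈ thresholdRegion m p.1} := by
    have : {p : (Fin (m + 1) ⊕ Fin (m + 1) → Square) × Square | p.2 ∈ thresholdRegion m p.1} =
        (⋂ s : Fin (m + 1), {p | (p.2.1 : ℝ) ≤ (((s : ℕ) : ℝ) - 1) / m} ∪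
          {p | (p.1 (.inl s)).2 ≤ p.2.2}) ∩
        ⋂ s : Fin (m + 1), {p | (((s : ℕ) : ℝ) + 1) / m ≤ (p.2.2 : ℝ)} ∪
          {p | p.2.1 ≤ (p.1 (.inr s)).1} := by
      ext p
      simp only [thresholdRegion, Set.mem_ofPred_eq, Set.mem_inter_iff, Set.mem_iInter,
        Set.mem_union, ← not_lt, imp_iff_not_or]
    rw [this]
    refine (MeasurableSet.iInter fun s => ?_).inter (MeasurableSet.iInter fun s => ?_)
    · exact (measurableSet_le (by fun_prop) (by fun_prop)).union
        (measurableSet_le (by fun_prop) (by fun_prop))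
    · exact (measurableSet_le (by fun_prop) (by fun_prop)).union
        (measurableSet_le (by fun_prop) (by fun_prop))
  have hcharge : Measurable fun p : (Fin (m + 1) ⊕ Fin (m + 1) → Square) × Square =>
      thresholdCharge m p.1 p.2 := by
    refine Measurable.sup (Measurable.iSup fun s => ?_) (Measurable.iSup fun s => ?_)
    · exact Measurable.ite (measurableSet_lt (by fun_prop) (by fun_prop)) (by fun_prop) (by fun_prop)
    · exact Measurable.ite (measurableSet_lt (by fun_prop) (by fun_prop)) (by fun_prop) (by fun_prop)
  have hpay : Measurable fun p : (Fin (m + 1) ⊕ Fin (m + 1) → Square) × Square =>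
      thresholdPay m p.1 p.2 := by
    refine Measurable.inf (Measurable.iInf fun s => ?_) (Measurable.iInf fun s => ?_)
    · exact Measurable.ite (measurableSet_lt (by fun_prop) (by fun_prop)) (by fun_prop) (by fun_prop)
    · exact Measurable.ite (measurableSet_lt (by fun_prop) (by fun_prop)) (by fun_prop) (by fun_prop)
  have : (fun p : (Fin (m + 1) ⊕ Fin (m + 1) → Square) × Square =>
      (myerson (thresholdRegion m p.1)).profit p.2) =
      fun p => if p.2 ∈ thresholdRegion m p.1 then
        (thresholdCharge m p.1 p.2 : ℝ) - thresholdPay m p.1 p.2 else 0 := by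
    funext p
    split_ifs with h
    · rw [Mechanism.profit, charge_thresholdRegion h, pay_thresholdRegion h]
    · exact profit_of_notMem h
  rw [this]
  exact Measurable.ite hmem (hcharge.subtype_val.sub hpay.subtype_val) measurable_const

/-! ### Complete paths along the border of a region -/

section Path

variable {P : Set Square}

lemma exists_next_right (hP : (gridX P).Finite) {x : unitInterval} (hx : x < 1) :
    ∃ x' ∈ gridX P, x < x' ∧ ∀ t ∈ gridX P, ¬ (x < t ∧ t < x') := by
  have hfin : (gridX P ∩ Set.Ioi x).Finite := hP.subset Set.inter_subset_left
  obtain ⟨x', hx', hmin⟩ := hfin.exists_minimal ⟨1, .inl (.inr rfl), hx⟩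
  refine ⟨x', hx'.1, hx'.2, fun t ht htt => ?_⟩
  exact absurd (hmin ⟨ht, htt.1⟩ htt.2.le) (not_le.2 htt.2)

lemma exists_next_above (hP : (gridY P).Finite) {x : unitInterval} (hx : x < 1) :
    ∃ x' ∈ gridY P, x < x' ∧ ∀ t ∈ gridY P, ¬ (x < t ∧ t < x') := by
  have hfin : (gridY P ∩ Set.Ioi x).Finite := hP.subset Set.inter_subset_left
  obtain ⟨x', hx', hmin⟩ := hfin.exists_minimal ⟨1, .inl (.inr rfl), hx⟩
  refine ⟨x', hx'.1, hx'.2, fun t ht htt => ?_⟩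
  exact absurd (hmin ⟨ht, htt.1⟩ htt.2.le) (not_le.2 htt.2)

/-- The path from `u` that goes right as long as it stays in `A`, and up otherwise. -/
lemma exists_border_path (hX : (gridX P).Finite) (hY : (gridY P).Finite) {A : Set Square}
    (hU : IsUpper A) (n : ℕ) : ∀ u ∈ A ∩ gridNodes P, (gridNodes P ∩ Set.Ioi u).ncard ≤ n →
    ∃ l : List Square, (u :: l).IsChain (GridEdge P) ∧ (∀ z ∈ u :: l, z ∈ A ∩ gridNodes P) ∧
      ((u :: l).getLast (List.cons_ne_nil _ _)).2 = 1 ∧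
      ∀ f ∈ A ∩ gridNodes P, u.2 ≤ f.2 → ∃ z ∈ u :: l, Dominates f z := by
  have hfin : (gridNodes P).Finite := hX.prod hY
  have hlt {u w : Square} (hw : w ∈ gridNodes P) (huw : u < w) :
      (gridNodes P ∩ Set.Ioi w).ncard < (gridNodes P ∩ Set.Ioi u).ncard := by
    refine Set.ncard_lt_ncard ?_ (hfin.subset Set.inter_subset_left)
    refine ⟨fun z hz => ⟨hz.1, huw.trans hz.2⟩, fun h => ?_⟩
    exact lt_irrefl w (Set.mem_Ioi.1 (h ⟨hw, huw⟩).2)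
  have hcons {u w : Square} {l : List Square} (hu : u ∈ A ∩ gridNodes P) (he : GridEdge P u w)
      (hc : (w :: l).IsChain (GridEdge P)) (hm : ∀ z ∈ w :: l, z ∈ A ∩ gridNodes P)
      (hl : ((w :: l).getLast (List.cons_ne_nil _ _)).2 = 1) :
      (u :: w :: l).IsChain (GridEdge P) ∧ (∀ z ∈ u :: w :: l, z ∈ A ∩ gridNodes P) ∧
      ((u :: w :: l).getLast (List.cons_ne_nil _ _)).2 = 1 := by
    refine ⟨List.isChain_cons_cons.2 ⟨he, hc⟩, ?_, by rwa [List.getLast_cons_cons]⟩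
    intro z hz
    rcases List.mem_cons.1 hz with rfl | hz
    exacts [hu, hm z hz]
  induction n with
  | zero =>
    intro u hu hn
    have h1 : u.1 = 1 := by
      by_contra h
      obtain ⟨x', hx', hlt', -⟩ := exists_next_right hX (lt_of_le_of_ne u.1.2.2 h)
      have := hlt (u := u) (w := (x', u.2)) ⟨hx', hu.2.2⟩ (Prod.lt_iff.2 (.inl ⟨hlt', le_rfl⟩))
      omega
    have h2 : u.2 = 1 := by
      by_contra h
      obtain ⟨x', hx', hlt', -⟩ := exists_next_above hY (lt_of_le_of_ne u.2.2.2 h)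
      have := hlt (u := u) (w := (u.1, x')) ⟨hu.2.1, hx'⟩ (Prod.lt_iff.2 (.inr ⟨le_rfl, hlt'⟩))
      omega
    exact ⟨[], by simp, by simpa using hu, h2, fun f _ h => ⟨u, by simp, h1 ▸ f.1.2.2, h⟩⟩
  | succ n ih =>
    intro u hu hn
    by_cases hright : ∃ x' ∈ gridX P, u.1 < x' ∧ (∀ t ∈ gridX P, ¬ (u.1 < t ∧ t < x')) ∧
        (x', u.2) ∈ A
    · obtain ⟨x', hx', hux, hnext, hxA⟩ := hright
      have hw : (x', u.2) ∈ gridNodes P := ⟨hx', hu.2.2⟩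
      have hcard := hlt (u := u) hw (Prod.lt_iff.2 (.inl ⟨hux, le_rfl⟩))
      obtain ⟨l, hc, hm, hl, hd⟩ := ih (x', u.2) ⟨hxA, hw⟩ (by omega)
      obtain ⟨hc', hm', hl'⟩ := hcons hu ⟨hu.2, hw, .inl ⟨rfl, hux, hnext⟩⟩ hc hm hl
      refine ⟨_ :: l, hc', hm', hl', fun f hf huf => ?_⟩
      obtain ⟨z, hz, hfz⟩ := hd f hf huf
      exact ⟨z, List.mem_cons_of_mem _ hz, hfz⟩
    -- If the next node to the right is outside `A`, then so is every node of this row beyond `u`;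
    -- thus `u` generates its row.
    · have hdom (f : Square) (hf : f ∈ A ∩ gridNodes P) (h2 : f.2 = u.2) : Dominates f u := by
        refine ⟨?_, h2.ge⟩
        by_contra! h
        obtain ⟨x', hx', hlt', hnext⟩ := exists_next_right hX (h.trans_le f.1.2.2)
        have hle : x' ≤ f.1 := by
          by_contra! h'; exact hnext _ hf.2.1 ⟨h, h'⟩
        exact hright ⟨x', hx', hlt', hnext, hU hf.1 ⟨hle, h2.le⟩⟩
      rcases eq_or_lt_of_le (show u.2 ≤ 1 from u.2.2.2) with h1 | h1
      · exact ⟨[], by simp, by simpa using hu, h1, fun f hf h =>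
          ⟨u, by simp, hdom f hf (le_antisymm (h1 ▸ f.2.2.2) h)⟩⟩
      · obtain ⟨y', hy', huy, hnext⟩ := exists_next_above hY h1
        have hw : (u.1, y') ∈ gridNodes P := ⟨hu.2.1, hy'⟩
        have hcard := hlt (u := u) hw (Prod.lt_iff.2 (.inr ⟨le_rfl, huy⟩))
        obtain ⟨l, hc, hm, hl, hd⟩ := ih (u.1, y') ⟨hU hu.1 ⟨le_rfl, huy.le⟩, hw⟩ (by omega)
        obtain ⟨hc', hm', hl'⟩ := hcons hu ⟨hu.2, hw, .inr ⟨rfl, huy, hnext⟩⟩ hc hm hl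
        refine ⟨_ :: l, hc', hm', hl', fun f hf huf => ?_⟩
        rcases eq_or_lt_of_le huf with h2 | h2
        · exact ⟨u, by simp, hdom f hf h2.symm⟩
        · have hle : y' ≤ f.2 := by
            by_contra! h'; exact hnext _ hf.2.2 ⟨h2, h'⟩
          obtain ⟨z, hz, hfz⟩ := hd f hf hle
          exact ⟨z, List.mem_cons_of_mem _ hz, hfz⟩

/-- The region of a complete path is generated by the nodes of the path. -/
lemma CompletePath.exists_node_of_mem_upRegion (π : CompletePath P) {z : Square}
    (hz : z ∈ upRegion π.curve) : ∃ u ∈ π.nodes, Dominates z u := by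
  obtain ⟨c, hc | ⟨u, w, huw, hc⟩, hzc⟩ := hz
  · exact ⟨c, hc, hzc⟩
  · have hedge : GridEdge P u w := by
      have := π.isChain.infix huw
      simpa using this
    have hu : u ∈ π.nodes := huw.subset (by simp)
    have hw : w ∈ π.nodes := huw.subset (by simp)
    rcases hedge.2.2 with ⟨h, -, -⟩ | ⟨h, -, -⟩
    · exact ⟨w, hw, hzc.1.trans hc.2.1, (h ▸ hc.1.2).trans hzc.2⟩
    · exact ⟨u, hu, hzc.1.trans (h ▸ hc.2.1), hc.1.2.trans hzc.2⟩

lemma exists_completePath (hX : (gridX P).Finite) (hY : (gridY P).Finite) {A : Set Square}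
    (hU : IsUpper A) (hne : A.Nonempty)
    (hgen : ∀ z ∈ A, ∃ f ∈ A ∩ gridNodes P, Dominates z f) :
    ∃ π : CompletePath P, upRegion π.curve = A := by
  obtain ⟨z₀, hz₀⟩ := hne
  obtain ⟨f₀, hf₀, -⟩ := hgen z₀ hz₀
  have hfin : (A ∩ gridNodes P).Finite := (hX.prod hY).subset Set.inter_subset_right
  -- The path starts on the left side at the lowest row with a node in `A`, so that no generating
  -- node is below its start.
  obtain ⟨f₁, hf₁, hmin⟩ := Set.exists_min_image _ (fun f : Square => f.2) hfin ⟨f₀, hf₀⟩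
  have hu : ((0, f₁.2) : Square) ∈ A ∩ gridNodes P :=
    ⟨hU hf₁.1 ⟨f₁.1.2.1, le_rfl⟩, .inl (.inl rfl), hf₁.2.2⟩
  obtain ⟨l, hc, hm, hl, hd⟩ := exists_border_path hX hY hU _ _ hu le_rfl
  let π : CompletePath P := ⟨(0, f₁.2) :: l, List.cons_ne_nil _ _, fun z hz => (hm z hz).2, hc,
    rfl, hl⟩
  refine ⟨π, Set.Subset.antisymm (fun z hz => ?_) (fun z hz => ?_)⟩
  · obtain ⟨u, hu, hzu⟩ := π.exists_node_of_mem_upRegion hz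
    exact hU (hm u hu).1 hzu
  · obtain ⟨f, hf, hzf⟩ := hgen z hz
    obtain ⟨u, hu, hfu⟩ := hd f hf (hmin f hf)
    exact ⟨u, .inl hu, hzf.trans hfu⟩

/-! ### Thresholds of a path region are grid coordinates -/

lemma CompletePath.rightInf_mem_gridY (π : CompletePath P) (ξ : ℝ) :
    rightInf (upRegion π.curve) ξ ∈ gridY P := by
  set T : Set unitInterval := Prod.snd '' {u | u ∈ π.nodes ∧ ξ < u.1}
  have hTfin : T.Finite := (π.nodes.finite_toSet.subset fun u hu => hu.1).image _
  have heq : rightInf (upRegion π.curve) ξ = sInf T := by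
    apply le_antisymm
    · refine le_sInf ?_
      rintro _ ⟨u, ⟨hu, hξ⟩, rfl⟩
      exact rightInf_le (z := u) ⟨u, .inl hu, Dominates.refl u⟩ hξ
    · refine le_sInf ?_
      rintro y ⟨x, hx, hA⟩
      obtain ⟨u, hu, hd⟩ := π.exists_node_of_mem_upRegion hA
      have hle : sInf T ≤ u.2 := sInf_le ⟨u, ⟨hu, lt_of_lt_of_le hx hd.1⟩, rfl⟩
      exact hle.trans hd.2
  rw [heq]
  rcases T.eq_empty_or_nonempty with h | h
  · rw [h, sInf_empty]; exact .inl (.inr rfl)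
  · obtain ⟨u, ⟨hu, -⟩, hu'⟩ := h.csInf_mem hTfin
    rw [← hu']; exact (π.mem_gridNodes u hu).2

lemma CompletePath.lowerSup_mem_gridX (π : CompletePath P) (η : ℝ) :
    lowerSup (upRegion π.curve) η ∈ gridX P := by
  set T : Set unitInterval := Prod.fst '' {u : Square | u ∈ π.nodes ∧ (u.2 : ℝ) < η}
  have hTfin : T.Finite := (π.nodes.finite_toSet.subset fun u hu => hu.1).image _
  have heq : lowerSup (upRegion π.curve) η = sSup T := by
    apply le_antisymm
    · refine sSup_le ?_
      rintro x ⟨y, hy, hA⟩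
      obtain ⟨u, hu, hd⟩ := π.exists_node_of_mem_upRegion hA
      exact hd.1.trans (le_sSup ⟨u, ⟨hu, lt_of_le_of_lt hd.2 hy⟩, rfl⟩)
    · refine sSup_le ?_
      rintro _ ⟨u, ⟨hu, hξ⟩, rfl⟩
      exact le_lowerSup (z := u) ⟨u, .inl hu, Dominates.refl u⟩ hξ
  rw [heq]
  rcases T.eq_empty_or_nonempty with h | h
  · rw [h, sSup_empty]; exact .inl (.inl rfl)
  · obtain ⟨u, ⟨hu, -⟩, hu'⟩ := h.csSup_mem hTfin
    rw [← hu']; exact (π.mem_gridNodes u hu).1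

end Path

/-! ### Coarsened regions lie on a small grid -/

/-- The sample, extended by two opposite corners of the square. -/
def extSample {n : ℕ} (S : Fin n → Square) : Fin n ⊕ Bool → Square :=
  Sum.elim S fun b => if b then (1, 1) else (0, 0)

lemma exists_extSample_snd {n : ℕ} {S : Fin n → Square} {y : unitInterval}
    (hy : y ∈ gridY (Set.range S)) : ∃ j, (extSample S j).2 = y := by
  obtain (rfl | rfl) | ⟨_, ⟨i, rfl⟩, rfl⟩ := hy
  exacts [⟨.inr false, rfl⟩, ⟨.inr true, rfl⟩, ⟨.inl i, rfl⟩]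

lemma exists_extSample_fst {n : ℕ} {S : Fin n → Square} {x : unitInterval}
    (hx : x ∈ gridX (Set.range S)) : ∃ j, (extSample S j).1 = x := by
  obtain (rfl | rfl) | ⟨_, ⟨i, rfl⟩, rfl⟩ := hx
  exacts [⟨.inr false, rfl⟩, ⟨.inr true, rfl⟩, ⟨.inl i, rfl⟩]

lemma CompletePath.exists_thresholds {n : ℕ} {S : Fin n → Square}
    (π : CompletePath (Set.range S)) (m : ℕ) :
    ∃ σ : Fin (m + 1) ⊕ Fin (m + 1) → Fin n ⊕ Bool,
      (∀ s : Fin (m + 1), (extSample S (σ (.inl s))).2 =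
        rightInf (upRegion π.curve) ((((s : ℕ) : ℝ) - 1) / m)) ∧
      ∀ s : Fin (m + 1), (extSample S (σ (.inr s))).1 =
        lowerSup (upRegion π.curve) ((((s : ℕ) : ℝ) + 1) / m) := by
  choose f hf using fun s : Fin (m + 1) =>
    exists_extSample_snd (π.rightInf_mem_gridY ((((s : ℕ) : ℝ) - 1) / m))
  choose g hg using fun s : Fin (m + 1) =>
    exists_extSample_fst (π.lowerSup_mem_gridX ((((s : ℕ) : ℝ) + 1) / m))
  exact ⟨Sum.elim f g, hf, hg⟩

/-- Rounding the abscissa up and the ordinate down to the grid crosses no line `k/m` and no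
threshold, so every constraint survives. -/
lemma exists_gridNode_coarsen {P : Set Square} (hX : (gridX P).Finite) (hY : (gridY P).Finite)
    {A : Set Square} {m : ℕ}
    (hgX : ∀ (x : unitInterval) (k : ℤ), (x : ℝ) = k / m → x ∈ gridX P)
    (hgY : ∀ (y : unitInterval) (k : ℤ), (y : ℝ) = k / m → y ∈ gridY P)
    (hl : ∀ k : ℤ, rightInf A (k / m) ∈ gridY P) (hr : ∀ k : ℤ, lowerSup A (k / m) ∈ gridX P)
    {z : Square} (hz : z ∈ coarsen m A) : ∃ f ∈ coarsen m A ∩ gridNodes P, Dominates z f := by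
  obtain ⟨x, ⟨hxg, hzx⟩, hxmin⟩ := Set.exists_min_image (gridX P ∩ Set.Ici z.1) id
    (hX.subset Set.inter_subset_left) ⟨1, .inl (.inr rfl), z.1.2.2⟩
  obtain ⟨y, ⟨hyg, hzy⟩, hymax⟩ := Set.exists_max_image (gridY P ∩ Set.Iic z.2) id
    (hY.subset Set.inter_subset_left) ⟨0, .inl (.inl rfl), z.2.2.1⟩
  refine ⟨(x, y), ⟨⟨fun k hk => ?_, fun k hk => ?_⟩, hxg, hyg⟩, hzx, hzy⟩
  · have hkz : (k / m : ℝ) < z.1 := by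
      by_contra! h
      have hx := hxmin ⟨k / m, z.1.2.1.trans h, hk.le.trans x.2.2⟩ ⟨hgX _ k rfl, h⟩
      exact absurd hx (not_le.2 hk)
    exact hymax _ ⟨hl k, hz.1 k hkz⟩
  · have hkz : (z.2 : ℝ) < k / m := by
      by_contra! h
      have hx := hymax ⟨k / m, y.2.1.trans hk.le, h.trans z.2.2.2⟩ ⟨hgY _ k rfl, h⟩
      exact absurd hx (not_le.2 hk)
    exact hxmin _ ⟨hr k, hz.2 k hkz⟩

/-- The coarsening of the region of a path on the sample grid is the region of a path on the grid
induced by the samples that occur among the thresholds and by the uniform grid. -/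
lemma CompletePath.exists_completePath_coarsen {n : ℕ} {S : Fin n → Square}
    (π : CompletePath (Set.range S)) (h : ℕ)
    (σ : Fin (2 ^ h + 1) ⊕ Fin (2 ^ h + 1) → Fin n ⊕ Bool)
    (hl : ∀ s : Fin (2 ^ h + 1), (extSample S (σ (.inl s))).2 =
        rightInf (upRegion π.curve) ((((s : ℕ) : ℝ) - 1) / (2 ^ h : ℕ)))
    (hr : ∀ s : Fin (2 ^ h + 1), (extSample S (σ (.inr s))).1 =
        lowerSup (upRegion π.curve) ((((s : ℕ) : ℝ) + 1) / (2 ^ h : ℕ)))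
    (I : Finset (Fin n)) (hI : ∀ s i, σ s = .inl i → i ∈ I) :
    ∃ π' : CompletePath (S '' (I : Set (Fin n)) ∪ uniformPoints (prec h)),
      upRegion π'.curve = coarsen (2 ^ h) (upRegion π.curve) := by
  set P := S '' (I : Set (Fin n)) ∪ uniformPoints (prec h)
  set A := upRegion π.curve
  have hm' : (0 : ℝ) < (2 ^ h : ℕ) := by positivity
  have hPfin : P.Finite := (I.finite_toSet.image _).union (finite_uniformPoints h)
  have hX : (gridX P).Finite := (Set.toFinite _).union (hPfin.image _)
  have hY : (gridY P).Finite := (Set.toFinite _).union (hPfin.image _)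
  have hσY (s) : (extSample S (σ s)).2 ∈ gridY P := by
    rcases hs : σ s with i | b
    · exact .inr ⟨_, .inl ⟨i, hI s i hs, rfl⟩, rfl⟩
    · cases b
      exacts [.inl (.inl rfl), .inl (.inr rfl)]
  have hσX (s) : (extSample S (σ s)).1 ∈ gridX P := by
    rcases hs : σ s with i | b
    · exact .inr ⟨_, .inl ⟨i, hI s i hs, rfl⟩, rfl⟩
    · cases b
      exacts [.inl (.inl rfl), .inl (.inr rfl)]
  have hne : A.Nonempty :=
    ⟨π.nodes.head π.ne_nil, _, .inl (List.head_mem _), Dominates.refl _⟩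
  refine exists_completePath hX hY (isUpper_coarsen _ _) (hne.mono (subset_coarsen _ _))
    fun z hz => exists_gridNode_coarsen hX hY (fun x k hk => ?_) (fun y k hk => ?_)
      (fun k => ?_) (fun k => ?_) hz
  · obtain h' | ⟨z, hz, rfl⟩ := mem_gridX_uniformPoints.2 ⟨k, hk⟩
    exacts [.inl h', .inr ⟨z, .inr hz, rfl⟩]
  · obtain h' | ⟨z, hz, rfl⟩ := mem_gridY_uniformPoints.2 ⟨k, hk⟩
    exacts [.inl h', .inr ⟨z, .inr hz, rfl⟩]
  · rcases lt_or_ge k 0 with h0 | h0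
    · have hneg : (((0 : ℕ) : ℝ) - 1) / (2 ^ h : ℕ) < 0 :=
        div_neg_of_neg_of_pos (by norm_num) hm'
      have e := hl 0
      rw [Fin.val_zero, rightInf_of_neg A hneg] at e
      rw [rightInf_of_neg A (div_neg_of_neg_of_pos (by exact_mod_cast h0) hm'), ← e]
      exact hσY _
    · lift k to ℕ using h0
      rcases lt_or_ge k (2 ^ h) with h1 | h1
      · have e := hl ⟨k + 1, by omega⟩
        have e' : (((k + 1 : ℕ) : ℝ) - 1) / (2 ^ h : ℕ) = ((k : ℤ) : ℝ) / (2 ^ h : ℕ) := by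
          push_cast; ring
        simp only [e'] at e
        rw [← e]; exact hσY _
      -- To the right of the square the infimum is over the empty set, hence `1`, itself a grid
      -- ordinate.
      · have hempty : {y | ∃ x : unitInterval, (((k : ℤ) : ℝ) / (2 ^ h : ℕ)) < x ∧ (x, y) ∈ A} =
            ∅ := by
          refine Set.eq_empty_iff_forall_notMem.2 ?_
          rintro y ⟨x, hx, -⟩
          have h2 := hx.trans_le x.2.2
          rw [div_lt_one hm'] at h2
          exact absurd (by exact_mod_cast h2) (not_lt.2 h1)
        rw [rightInf, hempty, sInf_empty]
        exact .inl (.inr rfl)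
  · rcases lt_or_ge ((2 ^ h : ℕ) : ℤ) k with h0 | h0
    · have hbig : 1 < (((2 ^ h : ℕ) : ℝ) + 1) / (2 ^ h : ℕ) := by
        rw [lt_div_iff₀ hm']; linarith
      have e := hr (Fin.last _)
      rw [Fin.val_last, lowerSup_of_one_lt A hbig] at e
      rw [lowerSup_of_one_lt A (by rw [lt_div_iff₀ hm', one_mul]; exact_mod_cast h0), ← e]
      exact hσX _
    · rcases lt_or_ge 0 k with h1 | h1
      · obtain ⟨s, rfl⟩ : ∃ s : ℕ, k = s + 1 := ⟨(k - 1).toNat, by omega⟩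
        have e := hr ⟨s, by omega⟩
        push_cast at e ⊢
        rw [← e]; exact hσX _
      · have hempty : {x | ∃ y : unitInterval, (y : ℝ) < ((k : ℝ) / (2 ^ h : ℕ)) ∧ (x, y) ∈ A} =
            ∅ := by
          refine Set.eq_empty_iff_forall_notMem.2 ?_
          rintro x ⟨y, hy, -⟩
          have h2 := (div_pos_iff_of_pos_right hm').1 (y.2.1.trans_lt hy)
          exact absurd (by exact_mod_cast h2) (not_lt.2 h1)
        rw [lowerSup, hempty, sSup_empty]
        exact .inl (.inl rfl)

/-! ### A multiplicative Chernoff bound for sample-dependent functions -/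

section Chernoff

variable {Ω : Type*} [MeasurableSpace Ω] (D : Measure Ω) [IsProbabilityMeasure D]

/-- Any slope above `1/2` would give decay below: the Chernoff exponent compares it with half the
mean. -/
lemma exp_neg_le_of_le_half {x : ℝ} (h0 : 0 ≤ x) (h1 : x ≤ 1 / 2) :
    Real.exp (-x) ≤ 1 - 3 / 4 * x := by
  have h2 : 1 + x + x ^ 2 / 2 ≤ Real.exp x := Real.quadratic_le_exp_of_nonneg h0
  have h3 : 0 < 1 - 3 / 4 * x := by linarith
  rw [Real.exp_neg]
  refine inv_le_of_inv_le₀ h3 (le_trans ?_ h2)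
  rw [inv_le_iff_one_le_mul₀ h3]
  nlinarith [mul_nonneg h0 h0, mul_nonneg h0 (mul_nonneg h0 h0), mul_nonneg h0 (sub_nonneg.2 h1)]

/-- Lower tail of a sum of i.i.d. variables with values in `[0,3]` and mean at least `6 * ε`. -/
lemma measure_sum_le {ι : Type*} [Fintype ι] {f : Ω → ℝ} (hf : Measurable f)
    (h0 : ∀ ω, 0 ≤ f ω) (h3 : ∀ ω, f ω ≤ 3) {ε : ℝ} (hε : 6 * ε ≤ ∫ ω, f ω ∂D) (a : ℝ) :
    Measure.pi (fun _ : ι => D) {w | ∑ i, f (w i) ≤ a} ≤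
      ENNReal.ofReal (Real.exp (a / 6 - 3 / 4 * ε * Fintype.card ι)) := by
  have hint : Integrable f D := Integrable.of_bound hf.aestronglyMeasurable 3
    (.of_forall fun ω => by rw [Real.norm_of_nonneg (h0 ω)]; exact h3 ω)
  -- Dividing by `6` brings `f` into `[0, 1/2]` and makes its mean at least `ε`.
  have hexpf : ∫ ω, Real.exp (-(f ω / 6)) ∂D ≤ Real.exp (-(3 / 4 * ε)) := by
    have h1 : ∫ ω, Real.exp (-(f ω / 6)) ∂D ≤ ∫ ω, (1 - 3 / 4 * (f ω / 6)) ∂D := by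
      refine integral_mono_of_nonneg (.of_forall fun ω => (Real.exp_pos _).le) ?_
        (.of_forall fun ω => exp_neg_le_of_le_half (by linarith [h0 ω]) (by linarith [h3 ω]))
      exact (integrable_const _).sub ((hint.div_const 6).const_mul _)
    have h2 : ∫ ω, (1 - 3 / 4 * (f ω / 6)) ∂D = 1 - 3 / 4 * ((∫ ω, f ω ∂D) / 6) := by
      rw [integral_sub (integrable_const _) ((hint.div_const 6).const_mul _),
        integral_const_mul, integral_div]
      simp
    have h4 := Real.add_one_le_exp (-(3 / 4 * ε))
    linarith
  have hprod : ∫ w, ∏ i, Real.exp (-(f (w i) / 6)) ∂Measure.pi (fun _ : ι => D) ≤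
      Real.exp (-(3 / 4 * ε * Fintype.card ι)) := by
    rw [integral_fintype_prod_eq_prod (f := fun (_ : ι) ω => Real.exp (-(f ω / 6)))]
    rw [Finset.prod_const, Finset.card_univ]
    calc _ ≤ Real.exp (-(3 / 4 * ε)) ^ Fintype.card ι :=
          pow_le_pow_left₀ (integral_nonneg fun _ => (Real.exp_pos _).le) hexpf _
      _ = _ := by rw [← Real.exp_nat_mul]; congr 1; ring
  have hmeas : Measurable fun w : ι → Ω => ∏ i, Real.exp (-(f (w i) / 6)) := by fun_prop
  have hint' : Integrable (fun w : ι → Ω => ∏ i, Real.exp (-(f (w i) / 6)))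
      (Measure.pi fun _ : ι => D) := by
    refine Integrable.of_bound hmeas.aestronglyMeasurable 1 (.of_forall fun w => ?_)
    rw [Real.norm_of_nonneg (Finset.prod_nonneg fun _ _ => (Real.exp_pos _).le)]
    refine Finset.prod_le_one (fun _ _ => (Real.exp_pos _).le) fun i _ => ?_
    rw [Real.exp_le_one_iff]; linarith [h0 (w i)]
  have hmarkov := mul_meas_ge_le_integral_of_nonneg
    (.of_forall fun w => Finset.prod_nonneg fun _ _ => (Real.exp_pos _).le) hint'
    (Real.exp (-(a / 6)))
  have hset : {w : ι → Ω | ∑ i, f (w i) ≤ a} =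
      {w | Real.exp (-(a / 6)) ≤ ∏ i, Real.exp (-(f (w i) / 6))} := by
    ext w
    simp only [Set.mem_ofPred_eq, ← Real.exp_sum, Real.exp_le_exp, Finset.sum_neg_distrib,
      ← Finset.sum_div]
    constructor <;> intro h <;> linarith
  rw [hset, ← ofReal_measureReal]
  refine ENNReal.ofReal_le_ofReal ?_
  rw [sub_eq_add_neg, Real.exp_add]
  have hpos := Real.exp_pos (a / 6)
  have h1 : Real.exp (a / 6) * Real.exp (-(a / 6)) = 1 := by rw [← Real.exp_add]; simp
  calc _ = Real.exp (a / 6) * (Real.exp (-(a / 6)) * _) := by rw [← mul_assoc, h1, one_mul]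
    _ ≤ _ := mul_le_mul_of_nonneg_left (hmarkov.trans hprod) hpos.le

/-- The lower tail bound for a function with parameters taken from the sample: the sampled points
that serve as parameters are discarded from the sum. -/
lemma measure_compressed_sum_le {n : ℕ} {κ : Type*} [Fintype κ] {Z : (κ → Ω) × Ω → ℝ}
    (hZ : Measurable Z) (h0 : ∀ p, 0 ≤ Z p) (h3 : ∀ p, Z p ≤ 3) {β : Type*} (c : β → Ω)
    (σ : κ → Fin n ⊕ β) {ε : ℝ} (hε : 0 ≤ ε) (a : ℝ) :
    Measure.pi (fun _ : Fin n => D) {S | 6 * ε ≤ ∫ ω, Z (fun k => Sum.elim S c (σ k), ω) ∂D ∧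
      ∑ i, Z (fun k => Sum.elim S c (σ k), S i) ≤ a} ≤
      ENNReal.ofReal (Real.exp (a / 6 - 3 / 4 * ε * (n - Fintype.card κ))) := by
  classical
  -- `p` marks the sample points used as parameters. Conditionally on them the function is fixed and
  -- the other points are i.i.d.; dropping the marked terms, all nonnegative, only lowers the sum.
  let p : Fin n → Prop := fun i => ∃ k, σ k = .inl i
  let θ : ({i // p i} → Ω) → κ → Ω := fun u k =>
    match hk : σ k with
    | .inl i => u ⟨i, k, hk⟩
    | .inr b => c b
  have hθ : Measurable θ := by
    refine measurable_pi_lambda _ fun k => ?_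
    simp only [θ]
    split
    · fun_prop
    · fun_prop
  have hθS (S : Fin n → Ω) : θ (fun i => S i) = fun k => Sum.elim S c (σ k) := by
    funext k
    simp only [θ]
    split <;> rename_i h <;> simp [h]
  let B : Set (({i // p i} → Ω) × ({i // ¬ p i} → Ω)) :=
    {q | 6 * ε ≤ ∫ ω, Z (θ q.1, ω) ∂D ∧ ∑ i, Z (θ q.1, q.2 i) ≤ a}
  have hint : Measurable fun u => ∫ ω, Z (θ u, ω) ∂D := by
    have : StronglyMeasurable (Function.uncurry fun u ω => Z (θ u, ω)) := by
      refine Measurable.stronglyMeasurable ?_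
      exact hZ.comp ((hθ.comp measurable_fst).prodMk measurable_snd)
    exact this.integral_prod_right.measurable
  have hB : MeasurableSet B := by
    have hsum : Measurable fun q : ({i // p i} → Ω) × ({i // ¬ p i} → Ω) =>
        ∑ i, Z (θ q.1, q.2 i) := Finset.measurable_sum _ fun i _ =>
      hZ.comp ((hθ.comp measurable_fst).prodMk ((measurable_pi_apply i).comp measurable_snd))
    have h1 : MeasurableSet {q : ({i // p i} → Ω) × ({i // ¬ p i} → Ω) |
        6 * ε ≤ ∫ ω, Z (θ q.1, ω) ∂D} :=
      measurableSet_le measurable_const (hint.comp measurable_fst)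
    exact h1.inter (measurableSet_le hsum measurable_const)
  have hmp := measurePreserving_piEquivPiSubtypeProd (fun _ : Fin n => D) p
  have hsub : {S | 6 * ε ≤ ∫ ω, Z (fun k => Sum.elim S c (σ k), ω) ∂D ∧
      ∑ i, Z (fun k => Sum.elim S c (σ k), S i) ≤ a} ⊆
      (MeasurableEquiv.piEquivPiSubtypeProd (fun _ : Fin n => Ω) p) ⁻¹' B := by
    rintro S ⟨hS1, hS2⟩
    refine ⟨?_, ?_⟩
    · change 6 * ε ≤ ∫ ω, Z (θ (fun i => S i), ω) ∂D
      rw [hθS]; exact hS1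
    · change ∑ i : {i // ¬ p i}, Z (θ (fun i => S i), S i) ≤ a
      rw [hθS]
      refine le_trans ?_ hS2
      rw [← Finset.sum_subtype (Finset.univ.filter fun i => ¬ p i) (by simp)
        fun i => Z (fun k => Sum.elim S c (σ k), S i)]
      exact Finset.sum_le_sum_of_subset_of_nonneg (Finset.subset_univ _) fun _ _ _ => h0 _
  refine (measure_mono hsub).trans ?_
  rw [hmp.measure_preimage hB.nullMeasurableSet, Measure.prod_apply hB]
  have hcard : (n : ℝ) - Fintype.card κ ≤ Fintype.card {i // ¬ p i} := by
    have h1 : Fintype.card {i // p i} ≤ Fintype.card κ := by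
      choose g hg using fun i : {i // p i} => i.2
      refine Fintype.card_le_of_injective g fun i j hij => ?_
      have := hg i
      rw [hij, hg j] at this
      exact Subtype.ext (Sum.inl_injective this).symm
    have h2 := Fintype.card_subtype_compl p
    rw [Fintype.card_fin] at h2
    have h3 : Fintype.card {i // p i} ≤ n := by
      simpa using Fintype.card_subtype_le p
    rw [h2, Nat.cast_sub h3]
    have : (Fintype.card {i // p i} : ℝ) ≤ Fintype.card κ := by exact_mod_cast h1
    linarith
  have hslice (u : {i // p i} → Ω) : Measure.pi (fun _ : {i // ¬ p i} => D) (Prod.mk u ⁻¹' B) ≤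
      ENNReal.ofReal (Real.exp (a / 6 - 3 / 4 * ε * (n - Fintype.card κ))) := by
    by_cases hu : 6 * ε ≤ ∫ ω, Z (θ u, ω) ∂D
    · have h1 := measure_sum_le D (ι := {i // ¬ p i}) (f := fun ω => Z (θ u, ω))
        (hZ.comp measurable_prodMk_left) (fun _ => h0 _) (fun _ => h3 _) hu a
      refine (measure_mono fun w hw => hw.2).trans (h1.trans (ENNReal.ofReal_le_ofReal ?_))
      rw [Real.exp_le_exp]
      have := mul_le_mul_of_nonneg_left hcard (show 0 ≤ 3 / 4 * ε by positivity)
      linarith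
    · have : Prod.mk u ⁻¹' B = ∅ := by
        ext w; exact ⟨fun hw => absurd hw.1 hu, fun h => h.elim⟩
      rw [this]; simp
  calc _ ≤ ∫⁻ _, ENNReal.ofReal (Real.exp (a / 6 - 3 / 4 * ε * (n - Fintype.card κ)))
          ∂Measure.pi (fun _ : {i // p i} => D) := lintegral_mono hslice
    _ = _ := by simp

end Chernoff

/-! ### The union bound -/

lemma two_mul_log_twenty_gt : 5 < 2 * Real.log 20 := by
  have h1 : Real.log 16 ≤ Real.log 20 := Real.log_le_log (by norm_num) (by norm_num)
  have h2 : Real.log 16 = 4 * Real.log 2 := by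
    rw [show (16 : ℝ) = 2 ^ 4 by norm_num, Real.log_pow]; norm_num
  have := Real.log_two_gt_d9
  linarith

/-- The Chernoff exponent is `-n/(4m)` up to a bounded term, and `n/m ≥ 2n/N`. This must beat the
logarithm of the number of choices, at most `5N log(n+2)`. -/
lemma union_bound_le {N m n : ℝ} {δ : ℝ} (hδ0 : 0 < δ) (hm : 1 ≤ m) (hN : 2 * m ≤ N)
    (hδ1 : δ < 1) (hn : 625 * N ^ 2 * (Real.log (20 / δ) + Real.log (20 * N)) ≤ n) :
    (6 * m + 4) * Real.log (n + 2) + (3 * (1 / m) * n / 6 -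
      3 / 4 * (1 / m) * (n - (6 * m + 4))) ≤ Real.log δ - Real.log N := by
  have hm0 : 0 < m := by linarith
  have hN1 : 1 ≤ N := by linarith
  have hN0 : 0 < N := by linarith
  rw [Real.log_div (by norm_num) hδ0.ne', Real.log_mul (by norm_num) hN0.ne'] at hn
  have h20 := two_mul_log_twenty_gt
  have hlogN := Real.log_nonneg hN1
  have hlogδ := Real.log_neg hδ0 hδ1
  set Λ := Real.log 20 - Real.log δ + (Real.log 20 + Real.log N) with hΛ
  have hΛ5 : 5 ≤ Λ := by linarith
  have hNN : N ≤ N ^ 2 := by nlinarith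
  have hΛn : 625 * N * Λ ≤ n / N := by
    rw [le_div_iff₀ hN0]; linarith [show 625 * N * Λ * N = 625 * N ^ 2 * Λ by ring]
  have hn0 : 0 ≤ n := le_trans (by positivity) hn
  have hlog10 : Real.log (100 * N ^ 2) ≤ 2 * Λ := by
    rw [show 100 * N ^ 2 = (10 * N) ^ 2 by ring, Real.log_pow,
      Real.log_mul (by norm_num) hN0.ne']
    have : Real.log 10 ≤ Real.log 20 := Real.log_le_log (by norm_num) (by norm_num)
    push_cast
    linarith
  -- Tangent bound `log x ≤ x - 1` at `x = (n+2)/(100 N²)`: the scale leaves only `n/(20N)` after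
  -- multiplication by `5N`.
  have hlogn : Real.log (n + 2) ≤ 2 * Λ + n / (100 * N ^ 2) := by
    have h1 := Real.log_le_sub_one_of_pos (show 0 < (n + 2) / (100 * N ^ 2) by positivity)
    rw [Real.log_div (by positivity) (by positivity), add_div] at h1
    have : 2 / (100 * N ^ 2) ≤ 1 := by rw [div_le_one (by positivity)]; nlinarith
    linarith
  have hlog0 : 0 ≤ Real.log (n + 2) := Real.log_nonneg (by linarith)
  have hK : (6 * m + 4) * Real.log (n + 2) ≤ 10 * N * Λ + n / N / 20 := by
    calc _ ≤ 5 * N * (2 * Λ + n / (100 * N ^ 2)) :=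
          mul_le_mul (by linarith) hlogn hlog0 (by positivity)
      _ = _ := by field_simp; ring
  have hexp : 3 * (1 / m) * n / 6 - 3 / 4 * (1 / m) * (n - (6 * m + 4)) =
      9 / 2 + 3 * (1 / m) - n / m / 4 := by field_simp; ring
  have h1m : 1 / m ≤ 1 := by rw [div_le_one hm0]; exact hm
  have hnm : 2 * (n / N) ≤ n / m := by
    rw [← mul_div_assoc, div_le_div_iff₀ hN0 hm0]; nlinarith
  have hΛN : Λ ≤ N * Λ := by nlinarith
  rw [hexp]
  linarith

/-! ### The gap between consecutive levels -/

/-- The gap between two consecutive approximations with parameters `p.1`, shifted and clamped to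
`[0,3]`. -/
noncomputable def gap (m : ℕ)
    (p : ((Fin (m + 1) ⊕ Fin (m + 1)) ⊕ (Fin (m * 2 + 1) ⊕ Fin (m * 2 + 1)) → Square) × Square) :
    ℝ :=
  max 0 (min 3 (2 / m + (myerson (thresholdRegion m fun k => p.1 (.inl k))).profit p.2 -
    (myerson (thresholdRegion (m * 2) fun k => p.1 (.inr k))).profit p.2))

lemma gap_nonneg {m : ℕ} (p) : 0 ≤ gap m p := le_max_left _ _

lemma gap_le_three {m : ℕ} (p) : gap m p ≤ 3 := max_le (by norm_num) (min_le_left _ _)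

lemma measurable_gap (m : ℕ) : Measurable (gap m) := by
  have h1 : Measurable fun p : ((Fin (m + 1) ⊕ Fin (m + 1)) ⊕
      (Fin (m * 2 + 1) ⊕ Fin (m * 2 + 1)) → Square) × Square =>
      ((fun k => p.1 (.inl k) : Fin (m + 1) ⊕ Fin (m + 1) → Square), p.2) := by fun_prop
  have h2 : Measurable fun p : ((Fin (m + 1) ⊕ Fin (m + 1)) ⊕
      (Fin (m * 2 + 1) ⊕ Fin (m * 2 + 1)) → Square) × Square =>
      ((fun k => p.1 (.inr k) : Fin (m * 2 + 1) ⊕ Fin (m * 2 + 1) → Square), p.2) := by fun_prop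
  exact measurable_const.max (measurable_const.min ((measurable_const.add
    ((measurable_profit_thresholdRegion m).comp h1)).sub
    ((measurable_profit_thresholdRegion (m * 2)).comp h2)))

/-- The samples on which the gap at mesh `1 / m` for some choice of sampled parameters is large in
expectation but small on the sample. -/
def badSamples (D : Measure Square) (n m : ℕ) : Set (Fin n → Square) :=
  ⋃ σ : (Fin (m + 1) ⊕ Fin (m + 1)) ⊕ (Fin (m * 2 + 1) ⊕ Fin (m * 2 + 1)) → Fin n ⊕ Bool,
    {S | 6 * (1 / m : ℝ) ≤ ∫ v, gap m (fun k => extSample S (σ k), v) ∂D ∧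
      ∑ i, gap m (fun k => extSample S (σ k), S i) ≤ 3 * (1 / m : ℝ) * n}

lemma measure_badSamples_le (D : Measure Square) [IsProbabilityMeasure D] {N m n : ℕ} {δ : ℝ}
    (hδ0 : 0 < δ) (hδ1 : δ < 1) (hm : 1 ≤ m) (hN : 2 * m ≤ N)
    (hn : 625 * (N : ℝ) ^ 2 * (Real.log (20 / δ) + Real.log (20 * N)) ≤ n) :
    Measure.pi (fun _ : Fin n => D) (badSamples D n m) ≤ ENNReal.ofReal (δ / N) := by
  refine (measure_iUnion_fintype_le _ _).trans ?_
  have hle (σ : (Fin (m + 1) ⊕ Fin (m + 1)) ⊕ (Fin (m * 2 + 1) ⊕ Fin (m * 2 + 1)) →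
      Fin n ⊕ Bool) := measure_compressed_sum_le D (measurable_gap m) gap_nonneg gap_le_three
        (fun b => if b then (1, 1) else (0, 0)) σ
        (ε := 1 / m) (by positivity) (3 * (1 / m : ℝ) * n)
  refine (Finset.sum_le_sum fun σ _ => hle σ).trans ?_
  have hm' : (1 : ℝ) ≤ m := by exact_mod_cast hm
  have hN' : 2 * (m : ℝ) ≤ N := by exact_mod_cast hN
  have hN0 : (0 : ℝ) < N := by linarith
  have key := union_bound_le hδ0 hm' hN' hδ1 hn
  rw [Finset.sum_const, Finset.card_univ, Fintype.card_fun, nsmul_eq_mul]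
  simp only [Fintype.card_sum, Fintype.card_fin, Fintype.card_bool]
  rw [← ENNReal.ofReal_natCast, ← ENNReal.ofReal_mul (by positivity)]
  refine ENNReal.ofReal_le_ofReal ?_
  rw [← Real.exp_log (show 0 < δ / N by positivity), Real.log_div hδ0.ne' hN0.ne']
  rw [← Real.exp_log (show (0 : ℝ) < (((n + 2) ^ (m + 1 + (m + 1) + (m * 2 + 1 + (m * 2 + 1))) : ℕ)
    : ℝ) by positivity), ← Real.exp_add, Real.exp_le_exp]
  push_cast
  rw [Real.log_pow]
  push_cast
  convert key using 2
  · ring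
  · ring

/-- For `Mstar` an empirical optimum on a good sample, one more halving of the mesh gains little in
expectation. -/
lemma integral_gap_lt {D : Measure Square} [IsProbabilityMeasure D] {n m : ℕ} (hm : 1 ≤ m)
    {S : Fin n → Square} (hS : S ∉ badSamples D n m) (π : CompletePath (Set.range S))
    (hopt : IsEmpiricalOptimum S π.mechanism) :
    ∫ v, ((myerson (coarsen m (upRegion π.curve))).profit v -
      (myerson (coarsen (m * 2) (upRegion π.curve))).profit v) ∂D < 4 * (1 / m : ℝ) := by
  obtain ⟨⟨⟨hA, -⟩, htri⟩, -, hmax⟩ := hopt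
  set A := upRegion π.curve
  have hA : IsClosed A := hA
  have htri : ∀ v ∈ A, v.1 ≤ v.2 := htri
  have hU : IsUpper A := isUpper_upRegion _
  have hm0 : (0 : ℝ) < m := by exact_mod_cast hm
  obtain ⟨σ₁, hl₁, hr₁⟩ := π.exists_thresholds m
  obtain ⟨σ₂, hl₂, hr₂⟩ := π.exists_thresholds (m * 2)
  have e₁ := coarsen_eq_thresholdRegion hm (A := A) (θ := fun k => extSample S (σ₁ k)) hl₁ hr₁
  have e₂ := coarsen_eq_thresholdRegion (by omega) (A := A) (θ := fun k => extSample S (σ₂ k))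
    hl₂ hr₂
  -- The clamp, which bounds `gap` for arbitrary parameters, is inactive at the true thresholds: the
  -- unshifted gap lies in `[-2/m, 1]` and `2/m ≤ 2`.
  have hgap (v : Square) : gap m (fun k => extSample S (Sum.elim σ₁ σ₂ k), v) =
      2 / m + ((myerson (coarsen m A)).profit v - (myerson (coarsen (m * 2) A)).profit v) := by
    have h1 := neg_le_profit_coarsen_sub hA hU hm htri two_ne_zero v
    have h2 := profit_coarsen_sub_le_one (m := m) (A := A) two_ne_zero v
    have h3 : (2 / m : ℝ) ≤ 2 := by
      rw [div_le_iff₀ hm0]; have : (1 : ℝ) ≤ m := by exact_mod_cast hm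
      linarith
    simp only [gap, Sum.elim_inl, Sum.elim_inr, ← e₁, ← e₂]
    rw [min_eq_right (by linarith), max_eq_right (by linarith)]
    ring
  by_contra! hge
  refine hS (Set.mem_iUnion.2 ⟨Sum.elim σ₁ σ₂, ?_, ?_⟩)
  · have hint : Integrable (fun v => gap m (fun k => extSample S (Sum.elim σ₁ σ₂ k), v)) D := by
      refine Integrable.of_bound
        ((measurable_gap m).comp measurable_prodMk_left).aestronglyMeasurable 3
        (.of_forall fun v => ?_)
      rw [Real.norm_of_nonneg (gap_nonneg _)]
      exact gap_le_three _
    have hX : ∫ v, ((myerson (coarsen m A)).profit v -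
        (myerson (coarsen (m * 2) A)).profit v) ∂D =
        ∫ v, gap m (fun k => extSample S (Sum.elim σ₁ σ₂ k), v) ∂D - 2 / m := by
      rw [← sub_eq_of_eq_add (show ∫ _, (2 / m : ℝ) ∂D = 2 / m + 0 by simp), sub_zero,
        ← integral_sub hint (integrable_const _)]
      simp only [hgap, add_sub_cancel_left]
    rw [hX] at hge
    have : 6 * (1 / m : ℝ) = 4 * (1 / m) + 2 / m := by ring
    linarith
  -- The competitor `coarsen m A` may trade below the diagonal, so optimality among all of
  -- `mechanisms` is needed here.
  · have h1 := hmax _ (myerson_mem_mechanisms (isClosed_coarsen m A) (isUpper_coarsen m A))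
    have h2 (i : Fin n) := profit_sub_le_profit_coarsen_of_triangle hA hU (m := m * 2) (by omega)
      htri (S i)
    have h3 := Finset.sum_le_sum fun i (_ : i ∈ Finset.univ) => h2 i
    rw [Finset.sum_sub_distrib] at h3
    simp only [hgap, Finset.sum_add_distrib, Finset.sum_sub_distrib, Finset.sum_const,
      Finset.card_univ, Fintype.card_fin, nsmul_eq_mul] at h3 ⊢
    have e : (n : ℝ) * (2 / (m * 2 : ℕ)) = n * (1 / m) := by
      push_cast; field_simp
    rw [e] at h3
    have e' : 3 * (1 / m : ℝ) * n = n * (2 / m) + n * (1 / m) := by ring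
    have h1 : ∑ i, (myerson (coarsen m A)).profit (S i) ≤ ∑ i, (myerson A).profit (S i) := h1
    rw [e']
    linarith

/-- With `H > 0` the grid has an interior line, which keeps the corner `(1, 0)` out of the
simplified region; at `H = 0` there is no level to check. -/
lemma approx_approx {M : Mechanism} (hA : IsClosed M.alloc) (hU : IsUpper M.alloc)
    (h01 : ((0, 1) : Square) ∈ M.alloc) (htri : ∀ v ∈ M.alloc, v.1 ≤ v.2) {h H : ℕ} (hH : 0 < H)
    (hhH : h ≤ H) : approx h (approx H M) = myerson (coarsen (2 ^ h) M.alloc) := by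
  have h10 : ((1, 0) : Square) ∉ M.alloc := fun h => absurd (htri _ h) (by simp)
  have h2 : 2 ≤ 2 ^ H :=
    calc 2 = 2 ^ 1 := rfl
      _ ≤ 2 ^ H := Nat.pow_le_pow_right (by norm_num) hH
  rw [approx_eq_myerson hA hU h01 h10, approx_eq_myerson (isClosed_coarsen (2 ^ H) M.alloc)
    (isUpper_coarsen _ _) (subset_coarsen _ _ h01) (corner_notMem_coarsen htri h2)]
  obtain ⟨c, rfl⟩ := Nat.exists_eq_add_of_le hhH
  change myerson (coarsen (2 ^ h) (coarsen (2 ^ (h + c)) M.alloc)) = _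
  rw [pow_add, coarsen_coarsen (by positivity)]

end BilateralTrade

open BilateralTrade in
theorem mainTheorem3 (D : MeasureTheory.Measure Square) [MeasureTheory.IsProbabilityMeasure D]
    (H : ℕ) (δ : ℝ) (hδ0 : 0 < δ) (hδ1 : δ < 1) (n : ℕ)
    (hn : 625 / prec H ^ 2 * (Real.log (20 / δ) + Real.log (20 / prec H)) ≤ (n : ℝ)) :
    ∃ E : Set (Fin n → Square), MeasurableSet E ∧
      ENNReal.ofReal (1 - δ) ≤ MeasureTheory.Measure.pi (fun _ : Fin n => D) E ∧
      ∀ S ∈ E, ∀ Mstar : Mechanism, IsEmpiricalOptimum S Mstar →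
        approx H Mstar ∈ targetNet D H S := by
  have hn' : 625 * ((2 ^ H : ℕ) : ℝ) ^ 2 *
      (Real.log (20 / δ) + Real.log (20 * ((2 ^ H : ℕ) : ℝ))) ≤ n := by
    have e : 625 / prec H ^ 2 = 625 * ((2 ^ H : ℕ) : ℝ) ^ 2 := by
      rw [prec_eq]; field_simp
    have e' : 20 / prec H = 20 * ((2 ^ H : ℕ) : ℝ) := by rw [prec_eq]; field_simp
    rwa [e, e'] at hn
  have hN1 : (1 : ℝ) ≤ (2 ^ H : ℕ) := by exact_mod_cast Nat.one_le_two_pow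
  set μ := Measure.pi (fun _ : Fin n => D)
  set bad : Set (Fin n → Square) := ⋃ h ∈ Finset.range H, badSamples D n (2 ^ h)
  have hbad : μ bad ≤ ENNReal.ofReal δ := by
    refine (measure_biUnion_finset_le _ _).trans ?_
    have hle : ∀ h ∈ Finset.range H, μ (badSamples D n (2 ^ h)) ≤
        ENNReal.ofReal (δ / (2 ^ H : ℕ)) := by
      intro h hh
      refine measure_badSamples_le D hδ0 hδ1 Nat.one_le_two_pow ?_ hn'
      rw [mul_comm, ← pow_succ]
      exact Nat.pow_le_pow_right (by norm_num) (Finset.mem_range.1 hh)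
    refine (Finset.sum_le_sum hle).trans ?_
    rw [Finset.sum_const, Finset.card_range, nsmul_eq_mul, ← ENNReal.ofReal_natCast,
      ← ENNReal.ofReal_mul (by positivity)]
    refine ENNReal.ofReal_le_ofReal ?_
    have hHN : (H : ℝ) ≤ (2 ^ H : ℕ) := by exact_mod_cast Nat.lt_two_pow_self.le
    rw [← mul_div_assoc, div_le_iff₀ (by linarith), mul_comm]
    exact mul_le_mul_of_nonneg_left hHN hδ0.le
  -- A measurable hull of the bad event has the same measure and spares proving that the event
  -- itself is measurable.
  refine ⟨(toMeasurable μ bad)ᶜ, (measurableSet_toMeasurable _ _).compl, ?_, ?_⟩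
  · rw [prob_compl_eq_one_sub (measurableSet_toMeasurable _ _), measure_toMeasurable,
      ENNReal.ofReal_sub _ hδ0.le, ENNReal.ofReal_one]
    exact tsub_le_tsub_left hbad 1
  intro S hS Mstar hopt
  have hSbad : S ∉ bad := fun h => hS (subset_toMeasurable _ _ h)
  obtain ⟨π, rfl⟩ := hopt.2.1
  have hA : IsClosed π.mechanism.alloc := hopt.1.1.1
  have htri : ∀ v ∈ π.mechanism.alloc, v.1 ≤ v.2 := hopt.1.2
  have hU : IsUpper π.mechanism.alloc := isUpper_upRegion _
  have h01 : ((0, 1) : Square) ∈ π.mechanism.alloc :=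
    ⟨π.nodes.head π.ne_nil, .inl (List.head_mem _), unitInterval.nonneg', unitInterval.le_one'⟩
  have h10 : ((1, 0) : Square) ∉ π.mechanism.alloc := fun h => absurd (htri _ h) (by simp)
  have happrox := approx_eq_myerson hA hU h01 h10 (h := H)
  refine ⟨?_, ?_, ⟨_, hopt.1, rfl⟩, fun h hh => ?_⟩
  · classical
    obtain ⟨σ, hl, hr⟩ := π.exists_thresholds (2 ^ H)
    have hcard : (Finset.univ.filter fun i => ∃ s, σ s = .inl i).card ≤ 4 * 2 ^ H := by
      have h1 : (Finset.univ.filter fun i => ∃ s, σ s = .inl i).card ≤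
          (Finset.univ : Finset (Fin (2 ^ H + 1) ⊕ Fin (2 ^ H + 1))).card := by
        have h0 : ((Finset.univ.filter fun i => ∃ s, σ s = .inl i).map .inl :
            Finset (Fin n ⊕ Bool)) ⊆ Finset.univ.image σ := by
          intro j hj
          obtain ⟨i, hi, rfl⟩ := Finset.mem_map.1 hj
          obtain ⟨s, hs⟩ := (Finset.mem_filter.1 hi).2
          exact Finset.mem_image.2 ⟨s, Finset.mem_univ _, hs⟩
        have h1 := Finset.card_le_card h0
        rw [Finset.card_map] at h1
        exact h1.trans Finset.card_image_le
      have h2 : (Finset.univ : Finset (Fin (2 ^ H + 1) ⊕ Fin (2 ^ H + 1))).card =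
          2 * 2 ^ H + 2 := by simp; ring
      have h3 : 1 ≤ 2 ^ H := Nat.one_le_two_pow
      omega
    have hnN : 4 * 2 ^ H ≤ n := by
      have h1 : (4 : ℝ) * (2 ^ H : ℕ) ≤ n := by
        refine le_trans ?_ hn'
        have h20 := two_mul_log_twenty_gt
        have := Real.log_nonneg hN1
        have := Real.log_neg hδ0 hδ1
        rw [Real.log_div (by norm_num) hδ0.ne', Real.log_mul (by norm_num) (by positivity)]
        have h5 : (5 : ℝ) ≤ Real.log 20 - Real.log δ + (Real.log 20 + Real.log (2 ^ H : ℕ)) := by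
          linarith
        calc (4 : ℝ) * (2 ^ H : ℕ) ≤ 625 * ((2 ^ H : ℕ) : ℝ) ^ 2 * 5 := by nlinarith
          _ ≤ _ := mul_le_mul_of_nonneg_left h5 (by positivity)
      exact_mod_cast h1
    -- The net requires exactly `4/ε` indices, so the index set is padded; extra grid lines do no
    -- harm, and `n` is large enough.
    obtain ⟨I, hI, hIcard⟩ := Finset.exists_superset_card_eq hcard (by simpa using hnN)
    obtain ⟨π', hπ'⟩ := π.exists_completePath_coarsen H σ hl hr I fun s i hs =>
      hI (Finset.mem_filter.2 ⟨Finset.mem_univ _, s, hs⟩)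
    refine Set.mem_iUnion₂.2 ⟨I, ?_, π', ?_⟩
    · change (I.card : ℝ) = 4 / prec H
      rw [hIcard, prec_eq]; push_cast; field_simp
    · rw [happrox]; exact congrArg myerson hπ'.symm
  · rw [happrox]
    exact myerson_mem_mechanisms (isClosed_coarsen _ _) (isUpper_coarsen _ _)
  · have hH : 0 < H := by omega
    rw [approx_approx hA hU h01 htri hH hh.le, approx_approx hA hU h01 htri hH hh, prec_eq,
      pow_succ]
    refine integral_gap_lt Nat.one_le_two_pow (fun hb => hSbad ?_) π hopt
    exact Set.mem_biUnion (Finset.mem_coe.2 (Finset.mem_range.2 hh)) hb
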